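/- Let $\mu,\nu\in\mathbf C$. The Lommel function $S_{\mu,\nu}(\zeta)$ is the solution of $\zeta^2y''+\zeta y'+(\zeta^2-\nu^2)y=\zeta^{\mu+1}$, analytic on the Riemann surface of $\log\zeta$, defined as follows. * If neither $\mu+\nu$ nor $\mu-\nu$ is an odd negative integer, $$S_{\mu,\nu}(\zeta)=\sum_{m=0}^\infty\frac{(-1)^m\zeta^{\mu+1+2m}}{\prod_{j=0}^m[(\mu+2j+1)^2-\nu^2]}+2^{\mu-1}\Gamma\Big(\frac{\mu-\nu+1}2\Big)\Gamma\Big(\frac{\mu+\nu+1}2\Big)\Big[J_\nu(\zeta)\sin\frac{(\mu-\nu)\pi}2-Y_\nu(\zeta)\cos\frac{(\mu-\nu)\pi}2\Big].$$ * $S_{-1,0}(\zeta)=\frac12\sum_{m\ge0}\frac{(-1)^m(\zeta/2)^{2m}}{(m!)^2}\big\{[\log\frac\zeta2-\psi(m+1)]^2-\frac12\psi'(m+1)+\frac{\pi^2}4\big\}$, where $\psi=\Gamma'/\Gamma$; for a positive integer $n$, $S_{-n-1,-n}(\zeta)=\frac{(-1)^n\zeta^n}{n!}\frac{d^n}{d(\zeta^2)^n}S_{-1,0}(\zeta)$;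 and for $-\nu\notin\{0,1,2,\dots\}$, $$S_{\nu-1,\nu}(\zeta)=\frac{\zeta^\nu\Gamma(\nu)}4\sum_{m\ge0}\frac{(-1)^m(\zeta/2)^{2m}}{m!\,\Gamma(\nu+m+1)}\big[2\log\zeta-2\log2-\psi(\nu+m+1)-\psi(m+1)\big]-2^{\nu-2}\pi\Gamma(\nu)Y_\nu(\zeta).$$ * If $\mu-\nu=-2p-1$ with an integer $p\ge0$ and $\nu\notin\{1,\dots,p\}$, $$S_{\mu,\nu}(\zeta)=\sum_{m=0}^{p-1}\frac{(-1)^m\zeta^{\nu-2p+2m}}{2^{2m+2}(-p)_{m+1}(\nu-p)_{m+1}}+\frac{(-1)^pS_{\nu-1,\nu}(\zeta)}{2^{2p}p!\,(1-\nu)_p},$$ where $(a)_m=a(a+1)\cdots(a+m-1)$. In the remaining cases, where $\mu+\nu$ is an odd negative integer, $S_{\mu,\nu}=S_{\mu,-\nu}$, which is covered by the preceding formula. For an integer $m$, consider the branch of $S_{\mu,\nu}$ on the sheet $(m-1)\pi<\arg<(m+1)\pi$, that is, $\zeta\mapsto S_{\mu,\nu}(\zeta e^{m\pi i})$ with $-\pi<\arg\zeta<\pi$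 ($m=0$ is the principal branch). Then $S_{\mu,\nu}(e^ze^{m\pi i})$, $|\operatorname{Im}z|<\pi$, extends to an entire function $F$ of $z$. The order $$\limsup_{r\to+\infty}\frac{\log\log\max_{|z|\le r}|F(z)|}{\log r}$$ of $F$ is finite if and only if $\mu+\nu=2p+1$ or $\mu-\nu=2p+1$ for some non-negative integer $p$. In that case, for each such $p$ and all $z\in\mathbf C$, $$F(z)=e^{(\mu-1)(z+m\pi i)}\sum_{k=0}^p(-1)^kc_k\,e^{-2kz},\qquad c_0=1,\quad c_k=\prod_{j=1}^k\big[(\mu-2j+1)^2-\nu^2\big].$$ -/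

import Mathlib

/-!
Lommel functions in a logarithmic coordinate.  The functions `ζ ^ a`, `log ζ`, `J_ν`, `Y_ν`,
`s_{μ,ν}`, `S_{μ,ν}` are multivalued on `ℂ ∖ {0}`; they are single valued on the Riemann surface of
the logarithm, which is identified with `ℂ` by `z = log ζ`.  The functions `...Log` below are the
functions on that surface, so `ζ ^ a` becomes `exp (a * z)` and `log ζ` becomes `z`.
-/

noncomputable section

namespace LommelFn

/-- The Bessel function of the first kind,
`J_ν(ζ) = ∑ (-1)^m (ζ/2)^(ν+2m) / (m! Γ(ν+m+1))`, with `log ζ = z`.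
(Mathlib's `Γ` is `0` at its poles, so `1/Γ` has its usual value `0` there.) -/
def besselJLog (ν z : ℂ) : ℂ :=
  ∑' m : ℕ, (-1 : ℂ) ^ m / ((m.factorial : ℂ) * Complex.Gamma (ν + m + 1)) *
    Complex.exp ((ν + 2 * m) * (z - Complex.log 2))

/-- The Bessel function of the second kind of integral order `n ≥ 0` (the classical series for
`lim_{ν → n} (J_ν cos νπ - J_{-ν}) / sin νπ`):
`π Y_n(ζ) = 2 J_n(ζ) log(ζ/2) - ∑_{k<n} (n-k-1)!/k! (ζ/2)^(2k-n)
  - ∑_k (-1)^k (ζ/2)^(n+2k) / (k! (n+k)!) (ψ(k+1) + ψ(n+k+1))`, with `log ζ = z`. -/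
def besselYNatLog (n : ℕ) (z : ℂ) : ℂ :=
  (1 / (Real.pi : ℂ)) *
    (2 * besselJLog n z * (z - Complex.log 2)
      - ∑ k ∈ Finset.range n, ((n - k - 1).factorial : ℂ) / (k.factorial : ℂ) *
          Complex.exp ((2 * (k : ℂ) - n) * (z - Complex.log 2))
      - ∑' k : ℕ, (-1 : ℂ) ^ k / ((k.factorial : ℂ) * ((n + k).factorial : ℂ)) *
          Complex.exp (((n : ℂ) + 2 * k) * (z - Complex.log 2)) *
          (Complex.digamma ((k : ℂ) + 1) + Complex.digamma ((n : ℂ) + k + 1)))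

open Classical in
/-- The Bessel function of the second kind of arbitrary complex order, with `log ζ = z`:
`(J_ν cos νπ - J_{-ν}) / sin νπ` if `ν` is not an integer, and `Y_{-n} = (-1)^n Y_n`. -/
def besselYLog (ν z : ℂ) : ℂ :=
  if h : ∃ n : ℕ, ν = n then besselYNatLog h.choose z
  else if h : ∃ n : ℕ, ν = -(n : ℂ) then (-1 : ℂ) ^ h.choose * besselYNatLog h.choose z
  else (besselJLog ν z * Complex.cos (ν * Real.pi) - besselJLog (-ν) z) /
    Complex.sin (ν * Real.pi)

/-- `s_{μ,ν}(ζ) = ∑_m (-1)^m ζ^(μ+1+2m) / ∏_{j=0}^{m} ((μ+2j+1)² - ν²)`, with `log ζ = z`. -/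
def smallLommelLog (μ ν z : ℂ) : ℂ :=
  ∑' m : ℕ, (-1 : ℂ) ^ m * Complex.exp ((μ + 1 + 2 * m) * z) /
    ∏ j ∈ Finset.range (m + 1), ((μ + 2 * j + 1) ^ 2 - ν ^ 2)

/-- `S_{μ,ν}` when neither `μ + ν` nor `μ - ν` is an odd negative integer:
`s_{μ,ν} + K (J_ν sin((μ-ν)π/2) - Y_ν cos((μ-ν)π/2))`,
`K = 2^(μ-1) Γ((μ-ν+1)/2) Γ((μ+ν+1)/2)`. -/
def lommelGenericLog (μ ν z : ℂ) : ℂ :=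
  smallLommelLog μ ν z +
    (2 : ℂ) ^ (μ - 1) * Complex.Gamma ((μ - ν + 1) / 2) * Complex.Gamma ((μ + ν + 1) / 2) *
      (besselJLog ν z * Complex.sin ((μ - ν) / 2 * Real.pi) -
        besselYLog ν z * Complex.cos ((μ - ν) / 2 * Real.pi))

/-- `S_{-1,0}(ζ) = (1/2) ∑ (-1)^m (ζ/2)^(2m)/(m!)² ((log(ζ/2) - ψ(m+1))² - ψ'(m+1)/2 + π²/4)`,
with `log ζ = z`. -/
def lommelNegOneZeroLog (z : ℂ) : ℂ :=
  (1 / 2) * ∑' m : ℕ, (-1 : ℂ) ^ m / (m.factorial : ℂ) ^ 2 *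
    Complex.exp (2 * m * (z - Complex.log 2)) *
    ((z - Complex.log 2 - Complex.digamma ((m : ℂ) + 1)) ^ 2
      - deriv Complex.digamma ((m : ℂ) + 1) / 2 + (Real.pi : ℂ) ^ 2 / 4)

/-- The operator `d/d(ζ²) = (1/(2ζ)) d/dζ`, in the coordinate `z = log ζ`. -/
def derivSq (f : ℂ → ℂ) (z : ℂ) : ℂ := deriv f z / (2 * Complex.exp (2 * z))

open Classical in
/-- `S_{ν-1,ν}`, with `log ζ = z`.
If `ν = -n`, `n ≥ 0`, it is `((-1)^n ζ^n / n!) (d/d(ζ²))^n S_{-1,0}`; otherwise it is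
`(1/4) Γ(ν) ζ^ν ∑ (-1)^m (ζ/2)^(2m) / (m! Γ(ν+m+1))
  (2 log ζ - 2 log 2 - ψ(ν+m+1) - ψ(m+1)) - 2^(ν-2) π Γ(ν) Y_ν`. -/
def lommelSubOneLog (ν z : ℂ) : ℂ :=
  if h : ∃ n : ℕ, ν = -(n : ℂ) then
    (-1 : ℂ) ^ h.choose * Complex.exp (h.choose * z) / (h.choose.factorial : ℂ) *
      (derivSq^[h.choose] lommelNegOneZeroLog) z
  else
    (1 / 4) * Complex.exp (ν * z) * Complex.Gamma ν *
      (∑' m : ℕ, (-1 : ℂ) ^ m * Complex.exp (2 * m * (z - Complex.log 2)) /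
        ((m.factorial : ℂ) * Complex.Gamma (ν + m + 1)) *
        (2 * z - (2 * Complex.log 2 + Complex.digamma (ν + m + 1)
          + Complex.digamma ((m : ℂ) + 1))))
    - (2 : ℂ) ^ (ν - 2) * Real.pi * Complex.Gamma ν * besselYLog ν z

/-- `S_{ν-2p-1,ν}`, `p ≥ 0`, `ν ∉ {1,…,p}`, by `p` applications of the recurrence
`S_{μ+2,ν}(ζ) = ζ^(μ+1) - ((μ+1)² - ν²) S_{μ,ν}(ζ)`, starting from `S_{ν-1,ν}`.
Here `(a)_m` is `(ascPochhammer ℂ m).eval a`. -/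
def lommelSingularLog (p : ℕ) (ν z : ℂ) : ℂ :=
  ∑ m ∈ Finset.range p, (-1 : ℂ) ^ m * Complex.exp ((ν - 2 * p + 2 * m) * z) /
      ((2 : ℂ) ^ (2 * m + 2) * (ascPochhammer ℂ (m + 1)).eval (-(p : ℂ)) *
        (ascPochhammer ℂ (m + 1)).eval (ν - p))
    + (-1 : ℂ) ^ p * lommelSubOneLog ν z /
      ((2 : ℂ) ^ (2 * p) * (p.factorial : ℂ) * (ascPochhammer ℂ p).eval (1 - ν))

open Classical in
/-- The Lommel function `S_{μ,ν}` for all complex `μ`, `ν`, with `log ζ = z`.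
If `μ - ν = -(2p+1)` and `ν ∉ {1,…,p}` it is given by the singular formula; if `μ + ν = -(2p+1)`
(and the first case does not apply) it is `S_{μ,-ν}`, as `S_{μ,ν}` is even in `ν`; if neither
`μ + ν` nor `μ - ν` is an odd negative integer it is given by the generic formula.
(If `μ - ν = -(2p+1)` and `ν ∈ {1,…,p}`, then `μ + ν = -(2(p-ν)+1)`, and the second case applies.) -/
def lommelLog (μ ν z : ℂ) : ℂ :=
  if h : ∃ p : ℕ, μ - ν = -(2 * p + 1) ∧ ∀ n : ℕ, 1 ≤ n → n ≤ p → ν ≠ n then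
    lommelSingularLog h.choose ν z
  else if h : ∃ p : ℕ, μ + ν = -(2 * p + 1) then
    lommelSingularLog h.choose (-ν) z
  else lommelGenericLog μ ν z

/-- The branches `S_{μ,ν}(ζ e^{mπi})`, `-π < arg ζ < π`, that is, `S_{μ,ν}` taken on the sheet
`(m-1)π < arg < (m+1)π` of the Riemann surface of the logarithm.  `m = 0` is the principal branch;
the even `m` give all the branches of `S_{μ,ν}` over the plane cut along the negative axis. -/
def lommelBranch (μ ν : ℂ) (m : ℤ) (ζ : ℂ) : ℂ :=
  lommelLog μ ν (Complex.log ζ + m * Real.pi * Complex.I)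

/-- `M(r, f) = max_{|z| ≤ r} |f z|`. -/
def maxModulus (f : ℂ → ℂ) (r : ℝ) : ℝ :=
  sSup ((fun z => ‖f z‖) '' Metric.closedBall 0 r)

/-- The order `limsup_{r → ∞} log log M(r, f) / log r` of an entire function. -/
def growthOrder (f : ℂ → ℂ) : EReal :=
  Filter.limsup
    (fun r : ℝ => ((Real.log (Real.log (maxModulus f r)) / Real.log r : ℝ) : EReal)) Filter.atTop

/-- `c_k = ∏_{m=1}^k ((μ-2m+1)² - ν²)`, `c_0 = 1`. -/
def coeff (μ ν : ℂ) (k : ℕ) : ℂ :=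
  ∏ m ∈ Finset.Icc 1 k, ((μ - 2 * (m : ℂ) + 1) ^ 2 - ν ^ 2)

end LommelFn

end

/-!
In the coordinate `z = log ζ` Lommel's equation is `y'' + (e^{2z} - ν²) y = e^{(μ+1)z}`, an equation
with entire coefficients.  Every formula in the definition of `S_{μ,ν}` is, or is built from, a
series `∑ (A_m + B_m z + C_m z²) e^{(a+2m)z}` with rapidly decreasing coefficients, so that
comparing coefficients shows that `lommelLog μ ν` is an entire solution
(`solvesBessel_lommelLog`).  All the branches are translates of this one entire function.

The order is treated by Fourier analysis.  The equation without right-hand side is invariant under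
`z ↦ z + πi`, so a nonzero space of its solutions of finite order, being of dimension at most two,
would contain an eigenvector `y` of this translation, and `e^{-az} y` would be `πi`-periodic for
some `a`.  Its Fourier coefficients satisfy `((a+2k)² - ν²) h_k + h_{k-1} = 0`; they therefore decay
no faster than `(k!)⁻²` as `k → ∞` unless they vanish, whereas finite order forces faster decay
(`eq_zero_of_recurrence`).  Hence there is at most one solution of finite order for a given
right-hand side (`eq_of_finiteGrowth`).

If `S_{μ,ν}` has finite order, uniqueness makes `e^{-(μ+1)z} S_{μ,ν}` itself `πi`-periodic.
Its coefficients of nonnegative index vanish as before, and those of negative index are the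
coefficients of the descending series `ζ^{μ-1} (1 - c_1 ζ⁻² + ⋯)`.  These grow factorially unless
the series terminates (`exists_eq_zero_of_recurrence`), which happens exactly when `μ + ν` or `μ - ν`
is an odd positive integer.  Conversely, in that case the defining formulas reduce to finite
exponential sums (`finiteGrowth_lommelLog`), and uniqueness identifies `S_{μ,ν}` with the terminating
descending series.
-/

namespace LommelFn

open Complex Filter Topology

/-! ### Bessel's equation in the logarithmic coordinate and the method of Frobenius -/

/-- `f` is entire and `f'' + (κ e^{2z} - ν²) f = r`.  With `κ = 1` this is Bessel's equation with a
right-hand side in the coordinate `z = log ζ`; `κ = 4` is the same equation in `z = log (ζ/2)`. -/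
structure SolvesBessel (κ ν : ℂ) (r f : ℂ → ℂ) : Prop where
  differentiable : Differentiable ℂ f
  eq : ∀ z, deriv (deriv f) z + (κ * exp (2 * z) - ν ^ 2) * f z = r z

theorem differentiable_deriv {f : ℂ → ℂ} (hf : Differentiable ℂ f) :
    Differentiable ℂ (deriv f) := by
  have h : ContDiff ℂ 2 f := hf.contDiff
  have h2 : ContDiff ℂ 1 (deriv f) := by
    have := (contDiff_succ_iff_deriv (n := 1) (f := f)).1 (by simpa [one_add_one_eq_two] using h)
    exact this.2.2
  exact h2.differentiable (by norm_num)

theorem deriv2_of_hasDerivAt {f f' f'' : ℂ → ℂ} (h : ∀ z, HasDerivAt f (f' z) z)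
    (h' : ∀ z, HasDerivAt f' (f'' z) z) (z : ℂ) : deriv (deriv f) z = f'' z := by
  have : deriv f = f' := funext fun z => (h z).deriv
  rw [this, (h' z).deriv]

namespace SolvesBessel

variable {κ ν : ℂ} {r r' f g : ℂ → ℂ}

theorem of_hasDerivAt {f' f'' : ℂ → ℂ} (h : ∀ z, HasDerivAt f (f' z) z)
    (h' : ∀ z, HasDerivAt f' (f'' z) z)
    (e : ∀ z, f'' z + (κ * exp (2 * z) - ν ^ 2) * f z = r z) : SolvesBessel κ ν r f :=
  ⟨fun z => (h z).differentiableAt, fun z => by rw [deriv2_of_hasDerivAt h h', e]⟩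

theorem congr (h : SolvesBessel κ ν r f) (hf : ∀ z, g z = f z) (hr : ∀ z, r' z = r z) :
    SolvesBessel κ ν r' g := by
  rw [funext hf, funext hr]; exact h

theorem add (h : SolvesBessel κ ν r f) (h' : SolvesBessel κ ν r' g) :
    SolvesBessel κ ν (fun z => r z + r' z) (fun z => f z + g z) := by
  refine of_hasDerivAt (f' := fun z => deriv f z + deriv g z)
    (f'' := fun z => deriv (deriv f) z + deriv (deriv g) z) (fun z => ?_) (fun z => ?_) fun z => ?_
  · exact (h.differentiable z).hasDerivAt.add (h'.differentiable z).hasDerivAt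
  · exact (differentiable_deriv h.differentiable z).hasDerivAt.add
      (differentiable_deriv h'.differentiable z).hasDerivAt
  · rw [← h.eq, ← h'.eq]; ring

theorem const_mul (c : ℂ) (h : SolvesBessel κ ν r f) :
    SolvesBessel κ ν (fun z => c * r z) (fun z => c * f z) := by
  refine of_hasDerivAt (f' := fun z => c * deriv f z)
    (f'' := fun z => c * deriv (deriv f) z) (fun z => ?_) (fun z => ?_) fun z => ?_
  · exact (h.differentiable z).hasDerivAt.const_mul c
  · exact (differentiable_deriv h.differentiable z).hasDerivAt.const_mul c
  · rw [← h.eq]; ring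

theorem sub (h : SolvesBessel κ ν r f) (h' : SolvesBessel κ ν r' g) :
    SolvesBessel κ ν (fun z => r z - r' z) (fun z => f z - g z) :=
  (h.add (h'.const_mul (-1))).congr (fun z => by ring) (fun z => by ring)

theorem comp_add (h : SolvesBessel κ ν r f) {κ' b : ℂ} (hb : κ * exp (2 * b) = κ') :
    SolvesBessel κ' ν (fun z => r (z + b)) (fun z => f (z + b)) := by
  refine of_hasDerivAt (f' := fun z => deriv f (z + b))
    (f'' := fun z => deriv (deriv f) (z + b)) (fun z => ?_) (fun z => ?_) fun z => ?_
  · exact (h.differentiable (z + b)).hasDerivAt.comp_add_const z b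
  · exact (differentiable_deriv h.differentiable (z + b)).hasDerivAt.comp_add_const z b
  · rw [← h.eq, ← hb, mul_add 2 z b, Complex.exp_add]; ring

/-- Passing from the coordinate `log (ζ/2)` to the coordinate `log ζ`. -/
theorem comp_sub_log_two (h : SolvesBessel 4 ν r f) :
    SolvesBessel 1 ν (fun z => r (z - log 2)) (fun z => f (z - log 2)) := by
  have : (4 : ℂ) * exp (2 * -log 2) = 1 := by
    rw [mul_neg, two_mul, Complex.exp_neg, Complex.exp_add, Complex.exp_log two_ne_zero]; norm_num
  exact (h.comp_add this)

theorem neg_order (h : SolvesBessel κ ν r f) : SolvesBessel κ (-ν) r f :=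
  ⟨h.differentiable, fun z => by rw [← h.eq z]; ring⟩

end SolvesBessel

/-- Coefficient sequences of entire power series. -/
def RapidDecay (A : ℕ → ℂ) : Prop := ∀ R : ℝ, 0 ≤ R → Summable fun m => ‖A m‖ * R ^ m

namespace RapidDecay

variable {A B : ℕ → ℂ}

theorem of_le (hA : RapidDecay A) {C : ℝ} {D : ℝ} (hD : 0 ≤ D)
    (h : ∀ m, ‖B m‖ ≤ C * D ^ m * ‖A m‖) : RapidDecay B := fun R hR => by
  refine Summable.of_nonneg_of_le (fun m => by positivity) (fun m => ?_)
    ((hA (D * R) (by positivity)).mul_left C)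
  calc ‖B m‖ * R ^ m ≤ C * D ^ m * ‖A m‖ * R ^ m := by gcongr; exact h m
    _ = C * (‖A m‖ * (D * R) ^ m) := by rw [mul_pow]; ring

theorem mul_of_le (hA : RapidDecay A) {C : ℝ} {D : ℝ} (hD : 0 ≤ D)
    (h : ∀ m, ‖B m‖ ≤ C * D ^ m) : RapidDecay fun m => B m * A m :=
  hA.of_le hD (C := C) fun m => by
    rw [norm_mul]; gcongr; exact h m

theorem const_mul (c : ℂ) (hA : RapidDecay A) : RapidDecay fun m => c * A m :=
  hA.mul_of_le (C := ‖c‖) zero_le_one fun m => by simp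

theorem add (hA : RapidDecay A) (hB : RapidDecay B) : RapidDecay fun m => A m + B m :=
  fun R hR => by
    refine Summable.of_nonneg_of_le (fun m => by positivity) (fun m => ?_)
      ((hA R hR).add (hB R hR))
    rw [← add_mul]; gcongr; exact norm_add_le _ _

theorem linear_mul (a b : ℂ) (hA : RapidDecay A) : RapidDecay fun m => (a + b * m) * A m :=
  hA.mul_of_le (C := ‖a‖ + ‖b‖) (D := 2) zero_le_two fun m => by
    have h1 : (m : ℝ) ≤ 2 ^ m := by exact_mod_cast Nat.lt_two_pow_self.le
    have h2 : (1 : ℝ) ≤ 2 ^ m := one_le_pow₀ one_le_two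
    calc ‖a + b * m‖ ≤ ‖a‖ + ‖b‖ * m := by
          refine (norm_add_le _ _).trans ?_; rw [norm_mul, Complex.norm_natCast]
      _ ≤ ‖a‖ * 2 ^ m + ‖b‖ * 2 ^ m := by
          gcongr; exact le_mul_of_one_le_right (norm_nonneg _) h2
      _ = _ := by ring

/-- A two-term recurrence whose factor decays makes the series entire. -/
theorem of_succ_le {C : ℝ} (h : ∀ᶠ m : ℕ in atTop, ‖A (m + 1)‖ ≤ C / (m + 1) * ‖A m‖) :
    RapidDecay A := fun R hR => by
  have ht : Tendsto (fun m : ℕ => C * R / ((m : ℝ) + 1)) atTop (𝓝 0) :=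
    (tendsto_const_div_atTop_nhds_zero_nat (C * R)).comp (tendsto_add_atTop_nat 1) |>.congr
      fun m => by simp
  refine summable_of_ratio_norm_eventually_le (r := 1 / 2) (by norm_num) ?_
  filter_upwards [h, ht.eventually_le_const (by norm_num : (0 : ℝ) < 1 / 2)] with m hm hm'
  rw [Real.norm_of_nonneg (by positivity), Real.norm_of_nonneg (by positivity)]
  calc ‖A (m + 1)‖ * R ^ (m + 1) ≤ C / (m + 1) * ‖A m‖ * R ^ (m + 1) := by gcongr
    _ = C * R / (m + 1) * (‖A m‖ * R ^ m) := by rw [pow_succ]; ring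
    _ ≤ _ := by gcongr

end RapidDecay

/-- `∑ A_m e^{(a+2m)z}`, that is, `ζ^a ∑ A_m ζ^{2m}` with `z = log ζ`. -/
noncomputable def expSeries (a : ℂ) (A : ℕ → ℂ) (z : ℂ) : ℂ := ∑' m : ℕ, A m * exp ((a + 2 * m) * z)

section expSeries

variable {a : ℂ} {A B C : ℕ → ℂ}

theorem norm_expSeries_term_le (a z : ℂ) (A : ℕ → ℂ) (m : ℕ) {R : ℝ} (hR : ‖z‖ ≤ R) :
    ‖A m * exp ((a + 2 * m) * z)‖ ≤ Real.exp (‖a‖ * R) * (‖A m‖ * Real.exp (2 * R) ^ m) := by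
  rw [norm_mul, ← Real.exp_nat_mul]
  have : ‖exp ((a + 2 * m) * z)‖ ≤ Real.exp (‖a‖ * R + m * (2 * R)) := by
    refine (Complex.norm_exp_le_exp_norm _).trans (Real.exp_le_exp.2 ?_)
    rw [norm_mul]
    have h1 : ‖a + 2 * m‖ ≤ ‖a‖ + 2 * m := by
      refine (norm_add_le _ _).trans ?_; rw [norm_mul, Complex.norm_natCast]; simp
    calc ‖a + 2 * m‖ * ‖z‖ ≤ (‖a‖ + 2 * m) * R := by gcongr
      _ = _ := by ring
  rw [Real.exp_add] at this
  calc ‖A m‖ * ‖exp ((a + 2 * m) * z)‖ ≤ _ := mul_le_mul_of_nonneg_left this (norm_nonneg _)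
    _ = _ := by ring

theorem RapidDecay.summable (hA : RapidDecay A) (a z : ℂ) :
    Summable fun m : ℕ => A m * exp ((a + 2 * m) * z) :=
  Summable.of_norm_bounded ((hA (Real.exp (2 * ‖z‖)) (Real.exp_pos _).le).mul_left _)
    fun m => norm_expSeries_term_le a z A m le_rfl

theorem hasDerivAt_expSeries (hA : RapidDecay A) (z : ℂ) :
    HasDerivAt (expSeries a A) (expSeries a (fun m => (a + 2 * m) * A m) z) z := by
  have hA' := hA.linear_mul a 2
  refine hasDerivAt_tsum_of_isPreconnected
    (g := fun (m : ℕ) z => A m * exp ((a + 2 * m) * z))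
    (g' := fun (m : ℕ) z => (a + 2 * m) * A m * exp ((a + 2 * m) * z))
    ((hA' (Real.exp (2 * (‖z‖ + 1))) (Real.exp_pos _).le).mul_left (Real.exp (‖a‖ * (‖z‖ + 1))))
    (Metric.isOpen_ball (x := (0 : ℂ)) (ε := ‖z‖ + 1))
    (convex_ball _ _).isPreconnected (fun m y _ => ?_) (fun m y hy => ?_)
    (y₀ := 0) (Metric.mem_ball_self (by positivity)) (hA.summable a 0) (by simp)
  · have := (((hasDerivAt_id y).const_mul (a + 2 * (m : ℂ))).cexp).const_mul (A m)
    refine this.congr_deriv ?_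
    simp only [id, mul_one]; ring
  · exact norm_expSeries_term_le a y (fun m => (a + 2 * m) * A m) m (by simpa using (Metric.mem_ball.1 hy).le)

theorem expSeries_add (hA : RapidDecay A) (hB : RapidDecay B) (z : ℂ) :
    expSeries a (fun m => A m + B m) z = expSeries a A z + expSeries a B z := by
  rw [expSeries, expSeries, expSeries, ← (hA.summable a z).tsum_add (hB.summable a z)]
  simp only [add_mul]

theorem expSeries_const_mul (c : ℂ) (A : ℕ → ℂ) (z : ℂ) :
    expSeries a (fun m => c * A m) z = c * expSeries a A z := by
  rw [expSeries, expSeries, ← tsum_mul_left]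
  simp only [mul_assoc]

/-- Applying the operator `y'' - ν² y + κ e^{2z} y` to `expSeries a A` gives the series with
coefficients `((a+2m)² - ν²) A_m + κ A_{m-1}`, the term with `A_{m-1}` being absent for `m = 0`. -/
theorem expSeries_bessel (κ ν : ℂ) (hA : RapidDecay A) (z : ℂ) :
    expSeries a (fun m => (a + 2 * m) * ((a + 2 * m) * A m)) z
      + (κ * exp (2 * z) - ν ^ 2) * expSeries a A z
      = (a ^ 2 - ν ^ 2) * A 0 * exp (a * z) +
        expSeries (a + 2) (fun m => ((a + 2 * (m + 1 : ℕ)) ^ 2 - ν ^ 2) * A (m + 1) + κ * A m) z := by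
  have hA2 := (hA.linear_mul a 2).linear_mul a 2
  have e1 : expSeries a (fun m => (a + 2 * m) * ((a + 2 * m) * A m)) z - ν ^ 2 * expSeries a A z
      = expSeries a (fun m => ((a + 2 * m) ^ 2 - ν ^ 2) * A m) z := by
    rw [sub_eq_add_neg, ← neg_mul, ← expSeries_const_mul, ← expSeries_add hA2 (hA.const_mul _)]
    congr 1; ext m; ring
  have hA3 : RapidDecay (fun m => ((a + 2 * m) ^ 2 - ν ^ 2) * A m) := by
    have := hA2.add (hA.const_mul (-ν ^ 2))
    convert this using 2; ring
  have e2 := (hA3.summable a z).tsum_eq_zero_add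
  have s3 := (summable_nat_add_iff 1).2 (hA3.summable a z)
  have s4 := (hA.summable a z).mul_left (κ * exp (2 * z))
  have e5 : (κ * exp (2 * z) - ν ^ 2) * expSeries a A z
      = κ * exp (2 * z) * expSeries a A z - ν ^ 2 * expSeries a A z := by ring
  rw [e5, add_sub_left_comm, e1, expSeries, expSeries, e2, ← tsum_mul_left, expSeries]
  rw [add_comm, add_assoc, ← s3.tsum_add s4]
  congr 1
  · simp
  · refine tsum_congr fun m => ?_
    have h1 : exp ((a + 2 + 2 * m) * z) = exp (2 * z) * exp ((a + 2 * m) * z) := by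
      rw [← Complex.exp_add]; ring_nf
    have h2 : exp ((a + 2 * (m + 1 : ℕ)) * z) = exp (2 * z) * exp ((a + 2 * m) * z) := by
      rw [← Complex.exp_add]; push_cast; ring_nf
    rw [h1, h2]; ring

theorem expSeries_of_eq_zero (h : ∀ m, A m = 0) (z : ℂ) : expSeries a A z = 0 := by
  simp [expSeries, h]

/-- The method of Frobenius for `∑ (A_m + B_m z + C_m z²) e^{(a+2m)z}`: comparing coefficients. -/
theorem solvesBessel_quadratic {κ ν ρ : ℂ} (hA : RapidDecay A) (hB : RapidDecay B)
    (hC : RapidDecay C)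
    (hC0 : (a ^ 2 - ν ^ 2) * C 0 = 0)
    (hCs : ∀ m : ℕ, ((a + 2 * (m + 1 : ℕ)) ^ 2 - ν ^ 2) * C (m + 1) + κ * C m = 0)
    (hB0 : (a ^ 2 - ν ^ 2) * B 0 + 4 * (a * C 0) = 0)
    (hBs : ∀ m : ℕ, ((a + 2 * (m + 1 : ℕ)) ^ 2 - ν ^ 2) * B (m + 1) + κ * B m
      + 4 * ((a + 2 * (m + 1 : ℕ)) * C (m + 1)) = 0)
    (hA0 : (a ^ 2 - ν ^ 2) * A 0 + 2 * (a * B 0) + 2 * C 0 = ρ)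
    (hAs : ∀ m : ℕ, ((a + 2 * (m + 1 : ℕ)) ^ 2 - ν ^ 2) * A (m + 1) + κ * A m
      + 2 * ((a + 2 * (m + 1 : ℕ)) * B (m + 1)) + 2 * C (m + 1) = 0) :
    SolvesBessel κ ν (fun z => ρ * exp (a * z))
      (fun z => expSeries a A z + z * expSeries a B z + z ^ 2 * expSeries a C z) := by
  have hA' := hA.linear_mul a 2
  have hB' := hB.linear_mul a 2
  have hC' := hC.linear_mul a 2
  have split : ∀ {X : ℕ → ℂ} (z : ℂ), RapidDecay X → expSeries a X z =
      X 0 * exp (a * z) + expSeries (a + 2) (fun m => X (m + 1)) z := by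
    intro X z hX
    rw [expSeries, (hX.summable a z).tsum_eq_zero_add]
    congr 1
    · simp
    · refine tsum_congr fun m => ?_
      push_cast; ring_nf
  have sh : ∀ {X : ℕ → ℂ}, RapidDecay X → RapidDecay fun m => X (m + 1) := by
    intro X hX R hR
    have h1 := (summable_nat_add_iff 1).2 (hX (R + 1) (by positivity))
    refine Summable.of_nonneg_of_le (fun m => by positivity) (fun m => ?_) h1
    gcongr
    calc R ^ m ≤ (R + 1) ^ m := by gcongr; linarith
      _ ≤ (R + 1) ^ (m + 1) := pow_le_pow_right₀ (by linarith) (by omega)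
  have rec' : ∀ {X : ℕ → ℂ}, RapidDecay X →
      RapidDecay fun m => ((a + 2 * (m + 1 : ℕ)) ^ 2 - ν ^ 2) * X (m + 1) + κ * X m := by
    intro X hX
    have := ((sh ((hX.linear_mul a 2).linear_mul a 2)).add ((sh hX).const_mul (-ν ^ 2))).add
      (hX.const_mul κ)
    convert this using 2; ring
  refine SolvesBessel.of_hasDerivAt
    (f' := fun z => expSeries a (fun m => (a + 2 * m) * A m) z
      + (1 * expSeries a B z + z * expSeries a (fun m => (a + 2 * m) * B m) z)
      + ((2 * z) * expSeries a C z + z ^ 2 * expSeries a (fun m => (a + 2 * m) * C m) z))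
    (f'' := fun z => expSeries a (fun m => (a + 2 * m) * ((a + 2 * m) * A m)) z
      + (1 * expSeries a (fun m => (a + 2 * m) * B m) z
        + (1 * expSeries a (fun m => (a + 2 * m) * B m) z
        + z * expSeries a (fun m => (a + 2 * m) * ((a + 2 * m) * B m)) z))
      + ((2 * 1 * expSeries a C z + (2 * z) * expSeries a (fun m => (a + 2 * m) * C m) z)
        + ((2 * z) * expSeries a (fun m => (a + 2 * m) * C m) z
        + z ^ 2 * expSeries a (fun m => (a + 2 * m) * ((a + 2 * m) * C m)) z)))
    (fun z => ?_) (fun z => ?_) (fun z => ?_)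
  · have hsq : HasDerivAt (fun z : ℂ => z ^ 2) (2 * z) z := by
      simpa using hasDerivAt_pow 2 z
    exact ((hasDerivAt_expSeries hA z).add ((hasDerivAt_id z).mul (hasDerivAt_expSeries hB z))).add
      (hsq.mul (hasDerivAt_expSeries hC z))
  · have hsq : HasDerivAt (fun z : ℂ => z ^ 2) (2 * z) z := by
      simpa using hasDerivAt_pow 2 z
    exact ((hasDerivAt_expSeries hA' z).add
      (((hasDerivAt_expSeries hB z).const_mul 1).add
        ((hasDerivAt_id z).mul (hasDerivAt_expSeries hB' z)))).add
      ((((hasDerivAt_id z).const_mul 2).mul (hasDerivAt_expSeries hC z)).add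
      (hsq.mul (hasDerivAt_expSeries hC' z)))
  · have eA := expSeries_bessel (a := a) κ ν hA z
    have eB := expSeries_bessel (a := a) κ ν hB z
    have eC := expSeries_bessel (a := a) κ ν hC z
    have zC := expSeries_of_eq_zero (a := a + 2) hCs z
    have zB := expSeries_of_eq_zero (a := a + 2) hBs z
    have zA := expSeries_of_eq_zero (a := a + 2) hAs z
    rw [expSeries_add (rec' hB) ((sh hC').const_mul 4), expSeries_const_mul] at zB
    rw [expSeries_add ((rec' hA).add ((sh hB').const_mul 2)) ((sh hC).const_mul 2),
      expSeries_add (rec' hA) ((sh hB').const_mul 2), expSeries_const_mul,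
      expSeries_const_mul] at zA
    have sB := split z hB'
    have sC := split z hC'
    have sC0 := split z hC
    simp only [Nat.cast_zero, mul_zero, add_zero] at sB sC
    linear_combination eA + z * eB + z ^ 2 * eC + zA + z * zB + z ^ 2 * zC + 2 * sB + 4 * z * sC
      + 2 * sC0 + exp (a * z) * (hA0 + z * hB0 + z ^ 2 * hC0)

theorem solvesBessel_linear {κ ν ρ : ℂ} (hA : RapidDecay A) (hB : RapidDecay B)
    (hB0 : (a ^ 2 - ν ^ 2) * B 0 = 0)
    (hBs : ∀ m : ℕ, ((a + 2 * (m + 1 : ℕ)) ^ 2 - ν ^ 2) * B (m + 1) + κ * B m = 0)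
    (hA0 : (a ^ 2 - ν ^ 2) * A 0 + 2 * (a * B 0) = ρ)
    (hAs : ∀ m : ℕ, ((a + 2 * (m + 1 : ℕ)) ^ 2 - ν ^ 2) * A (m + 1) + κ * A m
      + 2 * ((a + 2 * (m + 1 : ℕ)) * B (m + 1)) = 0) :
    SolvesBessel κ ν (fun z => ρ * exp (a * z))
      (fun z => expSeries a A z + z * expSeries a B z) := by
  have h0 : RapidDecay (fun _ => 0) := fun R hR => by simp
  refine (solvesBessel_quadratic (ρ := ρ) hA hB h0 (by simp) (by simp) (by simpa using hB0)
    (by simpa using hBs) (by simpa using hA0) (by simpa using hAs)).congr (fun z => ?_)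
    (fun z => rfl)
  rw [expSeries_of_eq_zero (A := fun _ => 0) fun _ => rfl]; ring

theorem solvesBessel_expSeries {κ ν ρ : ℂ} (hA : RapidDecay A)
    (hA0 : (a ^ 2 - ν ^ 2) * A 0 = ρ)
    (hAs : ∀ m : ℕ, ((a + 2 * (m + 1 : ℕ)) ^ 2 - ν ^ 2) * A (m + 1) + κ * A m = 0) :
    SolvesBessel κ ν (fun z => ρ * exp (a * z)) (expSeries a A) := by
  have h0 : RapidDecay (fun _ => 0) := fun R hR => by simp
  refine (solvesBessel_linear (ρ := ρ) hA h0 (by simp) (by simp) (by simpa using hA0)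
    (by simpa using hAs)).congr (fun z => ?_) (fun z => rfl)
  rw [expSeries_of_eq_zero (A := fun _ => 0) fun _ => rfl]; ring

end expSeries

/-! ### Bessel functions, `s_{μ,ν}`, the generic case and `S_{-1,0}` -/

/-- The coefficients `(-1)^m / (m! Γ(ν+m+1))` of `J_ν` in powers of `ζ/2`. -/
noncomputable def besselCoeff (ν : ℂ) (m : ℕ) : ℂ :=
  (-1) ^ m / ((m.factorial : ℂ) * Gamma (ν + m + 1))

theorem besselCoeff_succ (ν : ℂ) (m : ℕ) :
    (m + 1) * (ν + m + 1) * besselCoeff ν (m + 1) = -besselCoeff ν m := by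
  unfold besselCoeff
  rw [Nat.factorial_succ]
  push_cast
  have hm : (m : ℂ) + 1 ≠ 0 := Nat.cast_add_one_ne_zero m
  have hf : (m.factorial : ℂ) ≠ 0 := by exact_mod_cast m.factorial_ne_zero
  by_cases h : ν + m + 1 = 0
  · rw [h]; simp
  · rw [show ν + (m + 1) + 1 = (ν + m + 1) + 1 by ring, Gamma_add_one _ h]
    by_cases hG : Gamma (ν + m + 1) = 0
    · rw [hG]; simp
    · field_simp
      ring

theorem norm_add_natCast_ge (x : ℂ) (n : ℕ) : (n : ℝ) - ‖x‖ ≤ ‖x + n‖ := by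
  have := norm_sub_norm_le (n : ℂ) (-x)
  rw [Complex.norm_natCast, norm_neg, sub_neg_eq_add, add_comm (n : ℂ)] at this
  exact this

theorem rapidDecay_besselCoeff (ν : ℂ) : RapidDecay (besselCoeff ν) := by
  refine RapidDecay.of_succ_le (C := 1) ?_
  filter_upwards [eventually_ge_atTop ⌈‖ν‖⌉₊] with m hm
  have hm' : ‖ν‖ ≤ m := (Nat.le_ceil _).trans (by exact_mod_cast hm)
  have h1 : 1 ≤ ‖ν + m + 1‖ := by
    have := norm_add_natCast_ge ν (m + 1)
    push_cast at this
    rw [← add_assoc] at this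
    linarith
  have h2 := congrArg norm (besselCoeff_succ ν m)
  have h3 : ‖(m : ℂ) + 1‖ = m + 1 := by
    have := Complex.norm_natCast (m + 1); push_cast at this; exact this
  rw [norm_neg, norm_mul, norm_mul, h3] at h2
  rw [one_div, ← h2]
  have : 0 ≤ ‖besselCoeff ν (m + 1)‖ := norm_nonneg _
  field_simp
  exact le_mul_of_one_le_right this h1

/-- A sequence with bounded increments is at most geometric. -/
theorem exists_le_two_pow_of_succ {u d : ℕ → ℂ} (hu : ∀ m, u (m + 1) = u m + d m)
    (hd : Tendsto d atTop (𝓝 0)) : ∃ C, ∀ m, ‖u m‖ ≤ C * 2 ^ m := by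
  obtain ⟨D, hD⟩ := isBounded_iff_forall_norm_le.1 (Metric.isBounded_range_of_tendsto d hd)
  have hD' : ∀ m, ‖d m‖ ≤ D := fun m => hD _ ⟨m, rfl⟩
  have hD0 : 0 ≤ D := (norm_nonneg _).trans (hD' 0)
  refine ⟨‖u 0‖ + D, fun m => ?_⟩
  induction m with
  | zero => simpa using hD0
  | succ m ih =>
    have h2 : (1 : ℝ) ≤ 2 ^ m := one_le_pow₀ one_le_two
    have h3 : D ≤ (‖u 0‖ + D) * 2 ^ m := by nlinarith [norm_nonneg (u 0)]
    rw [hu, pow_succ]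
    calc ‖u m + d m‖ ≤ ‖u m‖ + ‖d m‖ := norm_add_le _ _
      _ ≤ (‖u 0‖ + D) * 2 ^ m + (‖u 0‖ + D) * 2 ^ m := add_le_add ih ((hD' m).trans h3)
      _ = _ := by ring

theorem tendsto_inv_add_natCast (x : ℂ) :
    Tendsto (fun m : ℕ => (x + m)⁻¹) atTop (𝓝 0) := by
  refine tendsto_inv₀_cobounded.comp ?_
  rw [← tendsto_norm_atTop_iff_cobounded]
  refine tendsto_atTop_mono (fun m => norm_add_natCast_ge x m) ?_
  exact tendsto_atTop_add_const_right _ _ tendsto_natCast_atTop_atTop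

section digamma

variable {ν : ℂ}

theorem digamma_add_natCast_succ (hν : ∀ k : ℕ, ν ≠ -(k + 1 : ℕ)) (m : ℕ) :
    digamma (ν + (m + 1 : ℕ) + 1) = digamma (ν + m + 1) + (ν + m + 1)⁻¹ := by
  rw [← digamma_apply_add_one]
  · push_cast; ring_nf
  · intro k hk
    refine hν (k + m) ?_
    push_cast
    linear_combination hk

theorem digamma_natCast_succ (m : ℕ) :
    digamma (((m + 1 : ℕ) : ℂ) + 1) = digamma ((m : ℂ) + 1) + ((m : ℂ) + 1)⁻¹ := by
  have := digamma_add_natCast_succ (ν := 0) (fun k h => by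
    rw [eq_comm, neg_eq_zero] at h; exact Nat.succ_ne_zero k (by exact_mod_cast h)) m
  simpa only [zero_add] using this

theorem exists_digamma_le (hν : ∀ k : ℕ, ν ≠ -(k + 1 : ℕ)) :
    ∃ C, ∀ m : ℕ, ‖digamma (ν + m + 1)‖ ≤ C * 2 ^ m :=
  exists_le_two_pow_of_succ (u := fun m : ℕ => digamma (ν + m + 1))
    (d := fun m : ℕ => (ν + m + 1)⁻¹) (digamma_add_natCast_succ hν)
    ((tendsto_inv_add_natCast (ν + 1)).congr fun m => by ring_nf)

theorem exists_digamma_natCast_le : ∃ C, ∀ m : ℕ, ‖digamma ((m : ℂ) + 1)‖ ≤ C * 2 ^ m :=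
  exists_le_two_pow_of_succ (u := fun m : ℕ => digamma ((m : ℂ) + 1))
    (d := fun m : ℕ => ((m : ℂ) + 1)⁻¹) digamma_natCast_succ
    ((tendsto_inv_add_natCast 1).congr fun m => by ring_nf)

theorem differentiableAt_digamma {s : ℂ} (hs : 0 < s.re) : DifferentiableAt ℂ digamma s := by
  have ho : IsOpen {s : ℂ | 0 < s.re} := isOpen_lt continuous_const continuous_re
  have hne : ∀ {s : ℂ}, 0 < s.re → ∀ m : ℕ, s ≠ -m := by
    intro s hs m h
    rw [h] at hs
    simp at hs
    exact absurd hs (not_lt.2 (Nat.cast_nonneg m))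
  have hG : DifferentiableOn ℂ Gamma {s : ℂ | 0 < s.re} := fun s hs =>
    (differentiableAt_Gamma s (hne hs)).differentiableWithinAt
  have h1 := (hG.deriv ho).differentiableAt (ho.mem_nhds hs)
  exact h1.div (differentiableAt_Gamma s (hne hs)) (Gamma_ne_zero (hne hs))

theorem deriv_digamma_natCast_succ (m : ℕ) :
    deriv digamma (((m + 1 : ℕ) : ℂ) + 1) =
      deriv digamma ((m : ℂ) + 1) - (((m : ℂ) + 1) ^ 2)⁻¹ := by
  set s : ℂ := (m : ℂ) + 1 with hs
  have hre : 0 < s.re := by simp [hs]; positivity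
  have hs0 : s ≠ 0 := fun h => by simp [h] at hre
  have h1 : HasDerivAt digamma (deriv digamma (s + 1)) (s + 1) :=
    (differentiableAt_digamma (by simp; linarith)).hasDerivAt
  have h2 := h1.comp_add_const s 1
  have h3 := (differentiableAt_digamma hre).hasDerivAt.add (hasDerivAt_inv hs0)
  have h4 : (fun x => digamma (x + 1)) =ᶠ[𝓝 s] (fun x => digamma x + x⁻¹) := by
    have ho : IsOpen {s : ℂ | 0 < s.re} := isOpen_lt continuous_const continuous_re
    filter_upwards [ho.mem_nhds hre] with x hx
    refine digamma_apply_add_one x fun k h => ?_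
    have hx : 0 < x.re := hx
    rw [h] at hx
    simp at hx
    exact absurd hx (not_lt.2 (Nat.cast_nonneg k))
  have h5 := (h3.congr_of_eventuallyEq h4).unique h2
  push_cast
  rw [← hs, ← h5, sub_eq_add_neg]

theorem exists_deriv_digamma_le :
    ∃ C, ∀ m : ℕ, ‖deriv digamma ((m : ℂ) + 1)‖ ≤ C * 2 ^ m := by
  refine exists_le_two_pow_of_succ (u := fun m : ℕ => deriv digamma ((m : ℂ) + 1))
    (d := fun m : ℕ => -(((m : ℂ) + 1) ^ 2)⁻¹) (fun m => ?_) ?_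
  · rw [deriv_digamma_natCast_succ, sub_eq_add_neg]
  · have := ((tendsto_inv_add_natCast 1).pow 2).neg
    simp only [zero_pow two_ne_zero, neg_zero] at this
    exact this.congr fun m => by rw [add_comm, inv_pow]

end digamma

section bessel

theorem besselJLog_eq (ν z : ℂ) : besselJLog ν z = expSeries ν (besselCoeff ν) (z - log 2) := rfl

theorem besselCoeff_recurrence (ν : ℂ) (m : ℕ) :
    ((ν + 2 * (m + 1 : ℕ)) ^ 2 - ν ^ 2) * besselCoeff ν (m + 1) + 4 * besselCoeff ν m = 0 := by
  push_cast
  linear_combination 4 * besselCoeff_succ ν m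

theorem solvesBessel_besselJLog (ν : ℂ) :
    SolvesBessel 1 ν (fun _ => 0) (besselJLog ν) :=
  (solvesBessel_expSeries (ρ := 0) (rapidDecay_besselCoeff ν) (by ring)
    (besselCoeff_recurrence ν)).comp_sub_log_two.congr (fun z => besselJLog_eq ν z)
    (fun z => by simp)

/-- The coefficients multiplying no logarithm in `logSeries`. -/
noncomputable def logCoeff (ν : ℂ) (m : ℕ) : ℂ :=
  -(digamma (ν + m + 1) + digamma ((m : ℂ) + 1)) * besselCoeff ν m

/-- `∑ (-1)^m (ζ/2)^(ν+2m) / (m! Γ(ν+m+1)) (2 log(ζ/2) - ψ(ν+m+1) - ψ(m+1))` with `w = log(ζ/2)`,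
which is common to `Y_n` and `S_{ν-1,ν}`. -/
noncomputable def logSeries (ν w : ℂ) : ℂ :=
  expSeries ν (logCoeff ν) w + w * expSeries ν (fun m => 2 * besselCoeff ν m) w

variable {ν : ℂ}

theorem rapidDecay_logCoeff (hν : ∀ k : ℕ, ν ≠ -(k + 1 : ℕ)) : RapidDecay (logCoeff ν) := by
  obtain ⟨C, hC⟩ := exists_digamma_le hν
  obtain ⟨D, hD⟩ := exists_digamma_natCast_le
  refine (rapidDecay_besselCoeff ν).mul_of_le (C := C + D) zero_le_two fun m => ?_
  rw [norm_neg, add_mul]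
  exact (norm_add_le _ _).trans (add_le_add (hC m) (hD m))

theorem solvesBessel_logSeries (hν : ∀ k : ℕ, ν ≠ -(k + 1 : ℕ)) :
    SolvesBessel 4 ν (fun w => 4 * ν * besselCoeff ν 0 * exp (ν * w)) (logSeries ν) := by
  refine solvesBessel_linear (rapidDecay_logCoeff hν) ((rapidDecay_besselCoeff ν).const_mul 2)
    (by ring) (fun m => ?_) (by ring) fun m => ?_
  · linear_combination 2 * besselCoeff_recurrence ν m
  · have h1 : ν + m + 1 ≠ 0 := fun h => hν m (by push_cast; linear_combination h)
    have h2 : (m : ℂ) + 1 ≠ 0 := Nat.cast_add_one_ne_zero m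
    have h3 := besselCoeff_succ ν m
    simp only [logCoeff]
    rw [digamma_add_natCast_succ hν, digamma_natCast_succ]
    have e1 : (ν + m + 1) * (ν + m + 1)⁻¹ = 1 := mul_inv_cancel₀ h1
    have e2 : ((m : ℂ) + 1) * ((m : ℂ) + 1)⁻¹ = 1 := mul_inv_cancel₀ h2
    push_cast
    linear_combination (-4 * (digamma (ν + m + 1) + digamma ((m : ℂ) + 1))) * h3
      - 4 * (m + 1) * besselCoeff ν (m + 1) * e1 - 4 * (ν + m + 1) * besselCoeff ν (m + 1) * e2

theorem solvesBessel_const_mul_exp (κ ν c s : ℂ) :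
    SolvesBessel κ ν (fun z => c * ((s ^ 2 - ν ^ 2) * exp (s * z) + κ * exp ((s + 2) * z)))
      (fun z => c * exp (s * z)) := by
  have h : ∀ c z : ℂ, HasDerivAt (fun z => c * exp (s * z)) ((c * s) * exp (s * z)) z := by
    intro c z
    refine ((((hasDerivAt_id z).const_mul s).cexp).const_mul c).congr_deriv ?_
    simp only [id, mul_one]; ring
  refine SolvesBessel.of_hasDerivAt (h c) (h (c * s)) fun z => ?_
  have e : exp ((s + 2) * z) = exp (2 * z) * exp (s * z) := by
    rw [← Complex.exp_add]; ring_nf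
  rw [e]; ring

/-- A finite exponential sum whose coefficients satisfy the recurrence has only the two boundary
terms on the right-hand side. -/
theorem solvesBessel_expSum (κ ν a : ℂ) (c : ℕ → ℂ) (N : ℕ)
    (h : ∀ k < N, ((a + 2 * (k + 1 : ℕ)) ^ 2 - ν ^ 2) * c (k + 1) + κ * c k = 0) :
    SolvesBessel κ ν
      (fun z => (a ^ 2 - ν ^ 2) * c 0 * exp (a * z) + κ * c N * exp ((a + 2 * (N + 1 : ℕ)) * z))
      (fun z => ∑ k ∈ Finset.range (N + 1), c k * exp ((a + 2 * k) * z)) := by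
  induction N with
  | zero =>
    refine (solvesBessel_const_mul_exp κ ν (c 0) a).congr (fun z => by simp) (fun z => ?_)
    push_cast; ring_nf
  | succ N ih =>
    refine ((ih fun k hk => h k (by omega)).add
      (solvesBessel_const_mul_exp κ ν (c (N + 1)) (a + 2 * (N + 1 : ℕ)))).congr (fun z => ?_)
      (fun z => ?_)
    · rw [Finset.sum_range_succ]
    · have e : a + 2 * ((N + 1 : ℕ) : ℂ) + 2 = a + 2 * ((N + 1 + 1 : ℕ) : ℂ) := by
        push_cast; ring
      rw [e]
      linear_combination -(exp ((a + 2 * (N + 1 : ℕ)) * z)) * h N (by omega)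

/-- The finite sum of non-logarithmic terms that is subtracted in `π Y_n`, with `w = log (ζ/2)`. -/
noncomputable def besselYPolar (n : ℕ) (w : ℂ) : ℂ :=
  ∑ k ∈ Finset.range n, ((n - k - 1).factorial : ℂ) / (k.factorial : ℂ) *
    exp ((2 * (k : ℂ) - n) * w)

theorem solvesBessel_besselYPolar (n : ℕ) :
    SolvesBessel 4 n (fun w => 4 * n * besselCoeff n 0 * exp (n * w)) (besselYPolar n) := by
  cases n with
  | zero =>
    refine (solvesBessel_const_mul_exp 4 _ 0 0).congr (fun z => ?_) (fun z => ?_) <;>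
      simp [besselYPolar]
  | succ N =>
    refine (solvesBessel_expSum 4 ((N + 1 : ℕ) : ℂ) (-((N + 1 : ℕ) : ℂ))
      (fun k => ((N + 1 - k - 1).factorial : ℂ) / (k.factorial : ℂ)) N fun k hk => ?_).congr
      (fun z => ?_) (fun z => ?_)
    · obtain ⟨d, rfl⟩ := Nat.exists_eq_add_of_lt hk
      have h1 : k + d + 1 + 1 - (k + 1) - 1 = d := by omega
      have h2 : k + d + 1 + 1 - k - 1 = d + 1 := by omega
      simp only [h1, h2, Nat.factorial_succ]
      have hf : (k.factorial : ℂ) ≠ 0 := by exact_mod_cast k.factorial_ne_zero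
      have hk : (k : ℂ) + 1 ≠ 0 := Nat.cast_add_one_ne_zero k
      push_cast
      field_simp
      ring
    · unfold besselYPolar
      refine Finset.sum_congr rfl fun k _ => ?_
      congr 2; ring
    · have e : besselCoeff ((N + 1 : ℕ) : ℂ) 0 = 1 / (N + 1).factorial := by
        simp only [besselCoeff, Nat.cast_zero, add_zero]
        rw [Gamma_nat_eq_factorial]; simp
      have e2 : -((N + 1 : ℕ) : ℂ) + 2 * ((N + 1 : ℕ) : ℂ) = ((N + 1 : ℕ) : ℂ) := by ring
      have e3 : N + 1 - N - 1 = 0 := by omega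
      simp only [e, e2, e3, Nat.factorial_succ, Nat.factorial_zero]
      have hf : (N.factorial : ℂ) ≠ 0 := by exact_mod_cast N.factorial_ne_zero
      have hk : (N : ℂ) + 1 ≠ 0 := Nat.cast_add_one_ne_zero N
      push_cast
      field_simp
      ring

theorem natCast_ne_neg_succ (n k : ℕ) : (n : ℂ) ≠ -((k + 1 : ℕ) : ℂ) := fun h => by
  have : ((n + (k + 1) : ℕ) : ℂ) = 0 := by push_cast at h ⊢; linear_combination h
  have := Nat.cast_eq_zero.1 this
  omega

theorem besselYNatLog_eq (n : ℕ) (z : ℂ) : besselYNatLog n z =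
    (1 / (Real.pi : ℂ)) * (logSeries n (z - log 2) - besselYPolar n (z - log 2)) := by
  unfold besselYNatLog logSeries
  rw [besselJLog_eq, expSeries_const_mul]
  have : ∑' k : ℕ, (-1 : ℂ) ^ k / ((k.factorial : ℂ) * ((n + k).factorial : ℂ)) *
          exp (((n : ℂ) + 2 * k) * (z - log 2)) *
          (digamma ((k : ℂ) + 1) + digamma ((n : ℂ) + k + 1)) =
      -expSeries n (logCoeff n) (z - log 2) := by
    rw [expSeries, ← tsum_neg]
    refine tsum_congr fun k => ?_
    have := Gamma_nat_eq_factorial (n + k)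
    push_cast at this
    rw [logCoeff, besselCoeff, this]; ring
  rw [this, besselYPolar]
  ring

theorem solvesBessel_besselYNatLog (n : ℕ) :
    SolvesBessel 1 n (fun _ => 0) (besselYNatLog n) :=
  ((((solvesBessel_logSeries (natCast_ne_neg_succ n)).sub
    (solvesBessel_besselYPolar n)).const_mul (1 / (Real.pi : ℂ))).comp_sub_log_two).congr
    (besselYNatLog_eq n) (fun z => by ring)

theorem besselYLog_natCast (n : ℕ) (z : ℂ) : besselYLog n z = besselYNatLog n z := by
  have h : ∃ k : ℕ, (n : ℂ) = k := ⟨n, rfl⟩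
  rw [besselYLog, dif_pos h, ← Nat.cast_injective h.choose_spec]

theorem solvesBessel_besselYLog (ν : ℂ) : SolvesBessel 1 ν (fun _ => 0) (besselYLog ν) := by
  by_cases h1 : ∃ n : ℕ, ν = n
  · obtain ⟨n, rfl⟩ := h1
    exact (solvesBessel_besselYNatLog n).congr (besselYLog_natCast n) fun _ => rfl
  by_cases h2 : ∃ n : ℕ, ν = -(n : ℂ)
  · have e := h2.choose_spec
    have := ((solvesBessel_besselYNatLog h2.choose).const_mul ((-1) ^ h2.choose)).neg_order
    rw [← e] at this
    exact this.congr (fun z => by rw [besselYLog, dif_neg h1, dif_pos h2]) (fun z => by simp)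
  · refine (((solvesBessel_besselJLog ν).const_mul (cos (ν * Real.pi) / sin (ν * Real.pi))).sub
      (((solvesBessel_besselJLog (-ν)).neg_order.const_mul (1 / sin (ν * Real.pi))).congr
        (fun z => rfl) (fun z => rfl) |> fun h => by rwa [neg_neg] at h)).congr (fun z => ?_)
        (fun z => by simp)
    rw [besselYLog, dif_neg h1, dif_neg h2]; ring

end bessel

section lommel

variable {μ ν : ℂ}

/-- The coefficients of `s_{μ,ν}`. -/
noncomputable def smallLommelCoeff (μ ν : ℂ) (m : ℕ) : ℂ :=
  (-1) ^ m / ∏ j ∈ Finset.range (m + 1), ((μ + 2 * j + 1) ^ 2 - ν ^ 2)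

theorem smallLommelLog_eq (μ ν z : ℂ) :
    smallLommelLog μ ν z = expSeries (μ + 1) (smallLommelCoeff μ ν) z := by
  unfold smallLommelLog expSeries smallLommelCoeff
  exact tsum_congr fun m => by ring

theorem smallLommelCoeff_succ (h : ∀ j : ℕ, (μ + 2 * j + 1) ^ 2 - ν ^ 2 ≠ 0) (m : ℕ) :
    ((μ + 1 + 2 * (m + 1 : ℕ)) ^ 2 - ν ^ 2) * smallLommelCoeff μ ν (m + 1)
      + 1 * smallLommelCoeff μ ν m = 0 := by
  have hm := h (m + 1)
  have e : μ + 1 + 2 * (m + 1 : ℕ) = μ + 2 * (m + 1 : ℕ) + 1 := by ring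
  have hP : ∏ j ∈ Finset.range (m + 1), ((μ + 2 * j + 1) ^ 2 - ν ^ 2) ≠ 0 :=
    Finset.prod_ne_zero_iff.2 fun j _ => h j
  rw [e, smallLommelCoeff, smallLommelCoeff, Finset.prod_range_succ _ (m + 1)]
  generalize ∏ j ∈ Finset.range (m + 1), ((μ + 2 * j + 1) ^ 2 - ν ^ 2) = P at hP
  generalize (μ + 2 * ((m + 1 : ℕ) : ℂ) + 1) ^ 2 - ν ^ 2 = Q at hm
  field_simp
  ring

theorem rapidDecay_smallLommelCoeff (h : ∀ j : ℕ, (μ + 2 * j + 1) ^ 2 - ν ^ 2 ≠ 0) :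
    RapidDecay (smallLommelCoeff μ ν) := by
  refine RapidDecay.of_succ_le (C := 1) ?_
  filter_upwards [eventually_ge_atTop ⌈‖μ + 1 - ν‖ + ‖μ + 1 + ν‖⌉₊] with m hm
  have hm' : ‖μ + 1 - ν‖ + ‖μ + 1 + ν‖ ≤ m := (Nat.le_ceil _).trans (by exact_mod_cast hm)
  have n1 := norm_nonneg (μ + 1 - ν)
  have n2 := norm_nonneg (μ + 1 + ν)
  have h1 := norm_add_natCast_ge (μ + 1 - ν) (2 * (m + 1))
  have h2 := norm_add_natCast_ge (μ + 1 + ν) (2 * (m + 1))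
  push_cast at h1 h2
  have h3 := smallLommelCoeff_succ h m
  have h4 : ((μ + 1 + 2 * (m + 1 : ℕ)) ^ 2 - ν ^ 2) =
      (μ + 1 - ν + 2 * (m + 1)) * (μ + 1 + ν + 2 * (m + 1)) := by push_cast; ring
  rw [h4, one_mul, ← eq_neg_iff_add_eq_zero] at h3
  have h5 := congrArg norm h3
  rw [norm_neg, norm_mul, norm_mul] at h5
  rw [one_div, ← h5, inv_mul_eq_div, le_div_iff₀ (by positivity), mul_comm]
  refine mul_le_mul_of_nonneg_right ?_ (norm_nonneg _)
  nlinarith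

theorem solvesBessel_smallLommelLog (h : ∀ j : ℕ, (μ + 2 * j + 1) ^ 2 - ν ^ 2 ≠ 0) :
    SolvesBessel 1 ν (fun z => exp ((μ + 1) * z)) (smallLommelLog μ ν) := by
  refine (solvesBessel_expSeries (ρ := 1) (rapidDecay_smallLommelCoeff h) ?_
    (smallLommelCoeff_succ h)).congr (smallLommelLog_eq μ ν) fun z => by simp
  have h0 := h 0
  simp only [Nat.cast_zero, mul_zero, add_zero] at h0
  simp [smallLommelCoeff, mul_inv_cancel₀ h0]

theorem solvesBessel_lommelGenericLog (h1 : ∀ p : ℕ, μ - ν ≠ -(2 * p + 1))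
    (h2 : ∀ p : ℕ, μ + ν ≠ -(2 * p + 1)) :
    SolvesBessel 1 ν (fun z => exp ((μ + 1) * z)) (lommelGenericLog μ ν) := by
  have h : ∀ j : ℕ, (μ + 2 * j + 1) ^ 2 - ν ^ 2 ≠ 0 := fun j hj => by
    have : (μ - ν + (2 * j + 1)) * (μ + ν + (2 * j + 1)) = 0 := by linear_combination hj
    rcases mul_eq_zero.1 this with h | h
    · exact h1 j (by linear_combination h)
    · exact h2 j (by linear_combination h)
  exact ((solvesBessel_smallLommelLog h).add
    ((((solvesBessel_besselJLog ν).const_mul (sin ((μ - ν) / 2 * Real.pi))).sub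
      ((solvesBessel_besselYLog ν).const_mul (cos ((μ - ν) / 2 * Real.pi)))).const_mul
      ((2 : ℂ) ^ (μ - 1) * Gamma ((μ - ν + 1) / 2) * Gamma ((μ + ν + 1) / 2)))).congr
    (fun z => by rw [lommelGenericLog]; ring) fun z => by simp

theorem solvesBessel_lommelNegOneZeroLog :
    SolvesBessel 1 0 (fun _ => 1) lommelNegOneZeroLog := by
  have hν : ∀ k : ℕ, (0 : ℂ) ≠ -(k + 1 : ℕ) := by simpa using natCast_ne_neg_succ 0
  obtain ⟨C, hC⟩ := exists_digamma_natCast_le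
  obtain ⟨D, hD⟩ := exists_deriv_digamma_le
  have hb := rapidDecay_besselCoeff 0
  have r1 : RapidDecay fun m => digamma ((m : ℂ) + 1) * besselCoeff 0 m :=
    hb.mul_of_le zero_le_two hC
  have r2 : RapidDecay fun m => digamma ((m : ℂ) + 1) * (digamma ((m : ℂ) + 1) * besselCoeff 0 m) :=
    r1.mul_of_le zero_le_two hC
  have r3 : RapidDecay fun m => deriv digamma ((m : ℂ) + 1) * besselCoeff 0 m :=
    hb.mul_of_le zero_le_two hD
  have rA : RapidDecay fun m => 1 / 2 * besselCoeff 0 m * (digamma ((m : ℂ) + 1) ^ 2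
      - deriv digamma ((m : ℂ) + 1) / 2 + (Real.pi : ℂ) ^ 2 / 4) := by
    have := ((r2.const_mul (1 / 2)).add (r3.const_mul (-1 / 4))).add
      (hb.const_mul ((Real.pi : ℂ) ^ 2 / 8))
    convert this using 2; ring
  have rB : RapidDecay fun m => -(digamma ((m : ℂ) + 1) * besselCoeff 0 m) := by
    simpa using r1.const_mul (-1)
  have rC := hb.const_mul (1 / 2)
  have b0 : besselCoeff 0 0 = 1 := by simp [besselCoeff]
  have main := solvesBessel_quadratic (a := 0) (κ := 4) (ν := 0) (ρ := 1) rA rB rC (by simp)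
    (fun m => ?_) (by simp) (fun m => ?_) (by simp [b0]) (fun m => ?_)
  · refine main.comp_sub_log_two.congr (fun z => ?_) fun z => by simp
    rw [lommelNegOneZeroLog, expSeries, expSeries, expSeries, ← tsum_mul_left, ← tsum_mul_left,
      ← tsum_mul_left, ← (rA.summable _ _).tsum_add ((rB.summable _ _).mul_left _),
      ← ((rA.summable _ _).add ((rB.summable _ _).mul_left _)).tsum_add
        ((rC.summable _ _).mul_left _)]
    refine tsum_congr fun m => ?_
    have := Gamma_nat_eq_factorial m
    rw [besselCoeff, zero_add, zero_add, this]
    ring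
  · linear_combination (1 / 2) * besselCoeff_recurrence 0 m
  all_goals
    have h2 : (m : ℂ) + 1 ≠ 0 := Nat.cast_add_one_ne_zero m
    have e2 : ((m : ℂ) + 1) * ((m : ℂ) + 1)⁻¹ = 1 := mul_inv_cancel₀ h2
    have h3 := besselCoeff_recurrence 0 m
    rw [digamma_natCast_succ]
    push_cast at h3 ⊢
  · linear_combination (-digamma ((m : ℂ) + 1)) * h3
      - 4 * (m + 1) * besselCoeff 0 (m + 1) * e2
  · have h4 := deriv_digamma_natCast_succ m
    push_cast at h4
    rw [h4]
    have e3 : ((m : ℂ) + 1) ^ 2 * (((m : ℂ) + 1) ^ 2)⁻¹ = 1 := mul_inv_cancel₀ (pow_ne_zero 2 h2)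
    set ψ := digamma ((m : ℂ) + 1)
    linear_combination
      (1 / 2 * (ψ ^ 2 - deriv digamma ((m : ℂ) + 1) / 2 + (Real.pi : ℂ) ^ 2 / 4)) * h3
      + besselCoeff 0 (m + 1) * ((4 * (m + 1) * ψ + 2 * (m + 1) * ((m : ℂ) + 1)⁻¹ + 2
        - 4) * e2 + e3)

end lommel

/-! ### The singular cases -/

section singular

/-- Iterating `d/d(ζ²)` on `S_{-1,0}`: the equation satisfied by `(d/d(ζ²))^n S_{-1,0}`. -/
theorem derivSq_iterate_lommelNegOneZeroLog (n : ℕ) :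
    Differentiable ℂ (derivSq^[n] lommelNegOneZeroLog) ∧
    ∀ z, deriv (deriv (derivSq^[n] lommelNegOneZeroLog)) z
      + 2 * n * deriv (derivSq^[n] lommelNegOneZeroLog) z
      + exp (2 * z) * (derivSq^[n] lommelNegOneZeroLog) z
      = (-1) ^ n * n.factorial * exp (-(2 * n) * z) := by
  induction n with
  | zero =>
    refine ⟨solvesBessel_lommelNegOneZeroLog.differentiable, fun z => ?_⟩
    have := solvesBessel_lommelNegOneZeroLog.eq z
    simp only [Function.iterate_zero, id, Nat.cast_zero]
    simp only [mul_zero, zero_mul, neg_zero, Complex.exp_zero, Nat.factorial_zero, pow_zero,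
      Nat.cast_one]
    linear_combination this
  | succ n ih =>
    obtain ⟨hU, hode⟩ := ih
    rw [Function.iterate_succ_apply']
    set U := derivSq^[n] lommelNegOneZeroLog with hUdef
    have hne : ∀ z : ℂ, 2 * exp (2 * z) ≠ 0 := fun z =>
      mul_ne_zero two_ne_zero (Complex.exp_ne_zero _)
    have hE : ∀ c z : ℂ, HasDerivAt (fun z => exp (c * z)) (c * exp (c * z)) z := fun c z => by
      simpa [mul_comm] using ((hasDerivAt_id z).const_mul c).cexp
    have hV : Differentiable ℂ (derivSq U) := by
      intro z
      exact (differentiable_deriv hU z).div ((hE 2 z).differentiableAt.const_mul 2) (hne z)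
    refine ⟨hV, fun z => ?_⟩
    have hV' := differentiable_deriv hV
    have eU : deriv U = fun z => 2 * exp (2 * z) * derivSq U z := by
      funext z
      rw [derivSq, mul_div_cancel₀ _ (hne z)]
    have eU1 : ∀ z, deriv (deriv U) z =
        2 * exp (2 * z) * (deriv (derivSq U) z + 2 * derivSq U z) := by
      intro z
      have h := (((hE 2 z).const_mul 2).mul (hV z).hasDerivAt)
      rw [eU]
      exact h.deriv.trans (by ring)
    have d3 : HasDerivAt (deriv (deriv U)) (2 * exp (2 * z) * (deriv (deriv (derivSq U)) z
        + 4 * deriv (derivSq U) z + 4 * derivSq U z)) z := by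
      have h := ((hE 2 z).const_mul 2).mul ((hV' z).hasDerivAt.add ((hV z).hasDerivAt.const_mul 2))
      rw [funext eU1]
      refine h.congr_deriv ?_
      simp only [Pi.add_apply]
      ring
    have dL := (d3.add ((differentiable_deriv hU z).hasDerivAt.const_mul (2 * (n : ℂ)))).add
      ((hE 2 z).mul (hU z).hasDerivAt)
    have dR := (hE (-(2 * n)) z).const_mul ((-1) ^ n * (n.factorial : ℂ))
    have key := (dL.congr_of_eventuallyEq (f₁ := fun z => (-1) ^ n * (n.factorial : ℂ) *
      exp (-(2 * n) * z)) (Eventually.of_forall fun z => by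
        simpa using (hode z).symm)).unique dR
    have hz := hode z
    rw [eU1 z, congrFun eU z] at hz
    rw [eU1 z, congrFun eU z] at key
    have e4 : exp (-(2 * n) * z) = exp (2 * z) * exp (-(2 * (n + 1 : ℕ)) * z) := by
      rw [← Complex.exp_add]; push_cast; ring_nf
    rw [e4] at hz key
    apply mul_left_cancel₀ (hne z)
    rw [Nat.factorial_succ]
    push_cast
    push_cast at hz key
    linear_combination key - 2 * hz

theorem solvesBessel_lommelSubOneLog_neg (n : ℕ) :
    SolvesBessel 1 n (fun z => exp (-n * z)) (fun z =>
      (-1 : ℂ) ^ n * exp (n * z) / (n.factorial : ℂ) * (derivSq^[n] lommelNegOneZeroLog) z) := by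
  obtain ⟨hU, hode⟩ := derivSq_iterate_lommelNegOneZeroLog n
  set U := derivSq^[n] lommelNegOneZeroLog
  have hE : ∀ c z : ℂ, HasDerivAt (fun z => exp (c * z)) (c * exp (c * z)) z := fun c z => by
    simpa [mul_comm] using ((hasDerivAt_id z).const_mul c).cexp
  have h1 : SolvesBessel 1 n (fun z => (-1) ^ n * n.factorial * exp (-n * z))
      (fun z => exp (n * z) * U z) := by
    refine SolvesBessel.of_hasDerivAt
      (f' := fun z => n * exp (n * z) * U z + exp (n * z) * deriv U z)
      (f'' := fun z => (n * (n * exp (n * z)) * U z + n * exp (n * z) * deriv U z)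
        + (n * exp (n * z) * deriv U z + exp (n * z) * deriv (deriv U) z))
      (fun z => (hE n z).mul (hU z).hasDerivAt)
      (fun z => (((hE n z).const_mul _).mul (hU z).hasDerivAt).add
        ((hE n z).mul (differentiable_deriv hU z).hasDerivAt)) fun z => ?_
    have e : exp (-n * z) = exp (n * z) * exp (-(2 * n) * z) := by
      rw [← Complex.exp_add]; ring_nf
    rw [e]
    linear_combination exp (n * z) * hode z
  have hf : (n.factorial : ℂ) ≠ 0 := by exact_mod_cast n.factorial_ne_zero
  refine (h1.const_mul ((-1) ^ n / n.factorial)).congr (fun z => by ring) fun z => ?_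
  have : ((-1 : ℂ) ^ n) * (-1) ^ n = 1 := by rw [← mul_pow]; simp
  field_simp
  linear_combination -this

variable {ν : ℂ}

theorem two_cpow_mul (x y : ℂ) : exp (x * y) = (2 : ℂ) ^ x * exp (x * (y - log 2)) := by
  rw [Complex.cpow_def_of_ne_zero two_ne_zero, ← Complex.exp_add]; ring_nf

theorem lommelSubOneLog_eq (hν : ∀ n : ℕ, ν ≠ -(n : ℂ)) (z : ℂ) :
    lommelSubOneLog ν z = (1 / 4) * Gamma ν * (2 : ℂ) ^ ν * logSeries ν (z - log 2)
      - (2 : ℂ) ^ (ν - 2) * Real.pi * Gamma ν * besselYLog ν z := by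
  have hd : ¬ ∃ n : ℕ, ν = -(n : ℂ) := fun ⟨n, h⟩ => hν n h
  rw [lommelSubOneLog, dif_neg hd, two_cpow_mul ν z]
  have r1 := (rapidDecay_logCoeff fun k => hν (k + 1)).summable ν (z - log 2)
  have r2 := ((rapidDecay_besselCoeff ν).const_mul 2).summable ν (z - log 2)
  have : logSeries ν (z - log 2) = exp (ν * (z - log 2)) *
      (∑' m : ℕ, (-1 : ℂ) ^ m * Complex.exp (2 * m * (z - Complex.log 2)) /
        ((m.factorial : ℂ) * Complex.Gamma (ν + m + 1)) *
        (2 * z - (2 * Complex.log 2 + Complex.digamma (ν + m + 1)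
          + Complex.digamma ((m : ℂ) + 1)))) := by
    rw [logSeries, expSeries, expSeries, ← tsum_mul_left, ← r1.tsum_add (r2.mul_left _),
      ← tsum_mul_left]
    refine tsum_congr fun m => ?_
    rw [add_mul ν, Complex.exp_add, logCoeff, besselCoeff]
    ring
  rw [this]
  ring

theorem solvesBessel_lommelSubOneLog (ν : ℂ) :
    SolvesBessel 1 ν (fun z => exp (ν * z)) (lommelSubOneLog ν) := by
  by_cases hd : ∃ n : ℕ, ν = -(n : ℂ)
  · have e := hd.choose_spec
    have h := (solvesBessel_lommelSubOneLog_neg hd.choose).neg_order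
    rw [← e] at h
    exact h.congr (fun z => by rw [lommelSubOneLog, dif_pos hd]) fun z => rfl
  · have hν : ∀ n : ℕ, ν ≠ -(n : ℂ) := fun n h => hd ⟨n, h⟩
    have h0 : ν ≠ 0 := by simpa using hν 0
    have hG : Gamma ν ≠ 0 := Gamma_ne_zero hν
    refine (((solvesBessel_logSeries fun k => hν (k + 1)).comp_sub_log_two.const_mul
      ((1 / 4) * Gamma ν * (2 : ℂ) ^ ν)).sub ((solvesBessel_besselYLog ν).const_mul
      ((2 : ℂ) ^ (ν - 2) * Real.pi * Gamma ν))).congr (lommelSubOneLog_eq hν) fun z => ?_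
    rw [two_cpow_mul ν z, besselCoeff]
    simp only [Nat.cast_zero, add_zero]
    rw [Gamma_add_one ν h0]
    simp only [pow_zero, Nat.factorial_zero, Nat.cast_one, one_mul, mul_zero, sub_zero]
    field_simp

theorem eval_ascPochhammer_neg_natCast (p : ℕ) :
    (ascPochhammer ℂ p).eval (-(p : ℂ)) = (-1) ^ p * p.factorial := by
  rw [ascPochhammer_eval_neg_eq_descPochhammer, descPochhammer_eval_eq_ascPochhammer, sub_self,
    zero_add, ascPochhammer_eval_one]

theorem eval_ascPochhammer_sub_natCast (p : ℕ) (ν : ℂ) :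
    (ascPochhammer ℂ p).eval (ν - p) = (-1) ^ p * (ascPochhammer ℂ p).eval (1 - ν) := by
  rw [← neg_sub, ascPochhammer_eval_neg_eq_descPochhammer, descPochhammer_eval_eq_ascPochhammer]
  congr 2; ring

theorem eval_ascPochhammer_ne_zero {x : ℂ} {n : ℕ} (h : ∀ k < n, x + k ≠ 0) :
    (ascPochhammer ℂ n).eval x ≠ 0 := by
  induction n with
  | zero => simp
  | succ n ih =>
    rw [ascPochhammer_succ_eval]
    exact mul_ne_zero (ih fun k hk => h k (by omega)) (h n (by omega))

theorem solvesBessel_lommelSingularLog {p : ℕ} (hν : ∀ n : ℕ, 1 ≤ n → n ≤ p → ν ≠ n) :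
    SolvesBessel 1 ν (fun z => exp ((ν - 2 * p) * z)) (lommelSingularLog p ν) := by
  have hT := solvesBessel_lommelSubOneLog ν
  cases p with
  | zero =>
    refine hT.congr (fun z => ?_) fun z => by simp
    simp [lommelSingularLog]
  | succ N =>
    have hf : ((N + 1).factorial : ℂ) ≠ 0 := by exact_mod_cast (N + 1).factorial_ne_zero
    have hP1 : ∀ k < N + 1, (-((N + 1 : ℕ) : ℂ)) + k ≠ 0 := fun k hk h => by
      have : (k : ℂ) = (N + 1 : ℕ) := by linear_combination h
      have := Nat.cast_injective this
      omega
    have hP2 : ∀ k < N + 1, (ν - ((N + 1 : ℕ) : ℂ)) + k ≠ 0 := fun k hk h => by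
      refine hν (N + 1 - k) (by omega) (by omega) ?_
      rw [Nat.cast_sub hk.le]
      linear_combination h
    set c : ℕ → ℂ := fun m => (-1 : ℂ) ^ m / ((2 : ℂ) ^ (2 * m + 2) *
      (ascPochhammer ℂ (m + 1)).eval (-((N + 1 : ℕ) : ℂ)) *
        (ascPochhammer ℂ (m + 1)).eval (ν - ((N + 1 : ℕ) : ℂ))) with hc
    have h1 := solvesBessel_expSum 1 ν (ν - 2 * ((N + 1 : ℕ) : ℂ)) c N fun k hk => by
      have a1 := eval_ascPochhammer_ne_zero fun j (hj : j < k + 1) => hP1 j (by omega)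
      have a2 := eval_ascPochhammer_ne_zero fun j (hj : j < k + 1) => hP2 j (by omega)
      have a3 := hP1 (k + 1) (by omega)
      have a4 := hP2 (k + 1) (by omega)
      have e : (ν - 2 * ((N + 1 : ℕ) : ℂ) + 2 * (k + 1 : ℕ)) ^ 2 - ν ^ 2 =
        4 * (-((N + 1 : ℕ) : ℂ) + (k + 1 : ℕ)) * (ν - ((N + 1 : ℕ) : ℂ) + (k + 1 : ℕ)) := by ring
      simp only [hc]
      rw [e, ascPochhammer_succ_eval (k + 1), ascPochhammer_succ_eval (k + 1)]
      generalize (ascPochhammer ℂ (k + 1)).eval (-((N + 1 : ℕ) : ℂ)) = X at a1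
      generalize (ascPochhammer ℂ (k + 1)).eval (ν - ((N + 1 : ℕ) : ℂ)) = Y at a2
      generalize -((N + 1 : ℕ) : ℂ) + (k + 1 : ℕ) = u at a3
      generalize ν - ((N + 1 : ℕ) : ℂ) + (k + 1 : ℕ) = v at a4
      rw [show 2 * (k + 1) + 2 = (2 * k + 2) + 2 by ring, pow_add]
      field_simp
      ring
    refine (h1.add (hT.const_mul ((-1 : ℂ) ^ (N + 1) / ((2 : ℂ) ^ (2 * (N + 1)) *
      ((N + 1).factorial : ℂ) * (ascPochhammer ℂ (N + 1)).eval (1 - ν))))).congr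
      (fun z => ?_) fun z => ?_
    · rw [lommelSingularLog]
      congr 1
      · refine Finset.sum_congr rfl fun k _ => ?_
        rw [hc]; ring
      · ring
    · have e : ν - 2 * ((N + 1 : ℕ) : ℂ) + 2 * ((N + 1 : ℕ) : ℂ) = ν := by ring
      have a2 := eval_ascPochhammer_ne_zero hP2
      rw [eval_ascPochhammer_sub_natCast] at a2
      have a3 := right_ne_zero_of_mul a2
      have b1 := hP1 0 (by omega)
      have b2 := hP2 0 (by omega)
      simp only [Nat.cast_zero, add_zero] at b1 b2
      have c0 : ((ν - 2 * ((N + 1 : ℕ) : ℂ)) ^ 2 - ν ^ 2) * c 0 = 1 := by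
        simp only [hc, zero_add, ascPochhammer_one, Polynomial.eval_X, pow_zero, mul_zero]
        generalize hX : ((N + 1 : ℕ) : ℂ) = X at b1 b2
        rw [mul_one_div, div_eq_one_iff_eq (mul_ne_zero (mul_ne_zero (by norm_num) b1) b2)]
        ring
      have cN : c N = -((-1 : ℂ) ^ (N + 1) / ((2 : ℂ) ^ (2 * (N + 1)) *
          ((N + 1).factorial : ℂ) * (ascPochhammer ℂ (N + 1)).eval (1 - ν))) := by
        simp only [hc]
        rw [eval_ascPochhammer_neg_natCast, eval_ascPochhammer_sub_natCast]
        have hs : ((-1 : ℂ) ^ (N + 1)) * (-1) ^ (N + 1) = 1 := by rw [← mul_pow]; simp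
        have e1 : (2 : ℂ) ^ (2 * N + 2) * ((-1) ^ (N + 1) * ((N + 1).factorial : ℂ)) *
          ((-1) ^ (N + 1) * (ascPochhammer ℂ (N + 1)).eval (1 - ν)) = (2 : ℂ) ^ (2 * (N + 1)) *
          ((N + 1).factorial : ℂ) * (ascPochhammer ℂ (N + 1)).eval (1 - ν) := by
          rw [show 2 * (N + 1) = 2 * N + 2 by ring]
          linear_combination (2 : ℂ) ^ (2 * N + 2) * ((N + 1).factorial : ℂ) *
            (ascPochhammer ℂ (N + 1)).eval (1 - ν) * hs
        rw [e1, ← neg_div]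
        congr 1
        rw [pow_succ]; ring
      rw [e, c0, cN]
      ring

end singular

section lommel

variable {μ ν : ℂ}

theorem add_ne_of_lommel_singular {p : ℕ} (h : μ + ν = -(2 * p + 1))
    (h1 : ¬ ∃ p : ℕ, μ - ν = -(2 * p + 1) ∧ ∀ n : ℕ, 1 ≤ n → n ≤ p → ν ≠ n) (n : ℕ)
    (hn : 1 ≤ n) (hnp : n ≤ p) : -ν ≠ n := fun e => by
  refine h1 ⟨p - n, ?_, fun k hk _ hk' => ?_⟩
  · rw [Nat.cast_sub hnp]; linear_combination h + 2 * e
  · have : ((k + n : ℕ) : ℂ) = 0 := by push_cast; linear_combination -hk' - e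
    have := Nat.cast_eq_zero.1 this
    omega

theorem sub_ne_of_lommel_generic
    (h1 : ¬ ∃ p : ℕ, μ - ν = -(2 * p + 1) ∧ ∀ n : ℕ, 1 ≤ n → n ≤ p → ν ≠ n)
    (h2 : ¬ ∃ p : ℕ, μ + ν = -(2 * p + 1)) (p : ℕ) : μ - ν ≠ -(2 * p + 1) := fun h => by
  refine h1 ⟨p, h, fun n _ hnp e => h2 ⟨p - n, ?_⟩⟩
  rw [Nat.cast_sub hnp]; linear_combination h + 2 * e

theorem solvesBessel_lommelLog (μ ν : ℂ) :
    SolvesBessel 1 ν (fun z => exp ((μ + 1) * z)) (lommelLog μ ν) := by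
  by_cases h1 : ∃ p : ℕ, μ - ν = -(2 * p + 1) ∧ ∀ n : ℕ, 1 ≤ n → n ≤ p → ν ≠ n
  · have hs := h1.choose_spec
    refine (solvesBessel_lommelSingularLog hs.2).congr
      (fun z => by rw [lommelLog, dif_pos h1]) fun z => ?_
    congr 2; linear_combination hs.1
  by_cases h2 : ∃ p : ℕ, μ + ν = -(2 * p + 1)
  · have hs := h2.choose_spec
    have h := (solvesBessel_lommelSingularLog (add_ne_of_lommel_singular hs h1)).neg_order
    rw [neg_neg] at h
    refine h.congr (fun z => by rw [lommelLog, dif_neg h1, dif_pos h2]) fun z => ?_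
    congr 2; linear_combination hs
  · exact (solvesBessel_lommelGenericLog (sub_ne_of_lommel_generic h1 h2)
      fun p h => h2 ⟨p, h⟩).congr (fun z => by rw [lommelLog, dif_neg h1, dif_neg h2]) fun _ => rfl

end lommel

/-! ### Entire functions of finite order -/

/-- `f` is bounded by `exp (C (1 + |z|)^K)` for some `C` and `K`; for entire `f` this says that the
order of `f` is finite. -/
def FiniteGrowth (f : ℂ → ℂ) : Prop :=
  ∃ (C : ℝ) (K : ℕ), 0 ≤ C ∧ ∀ z, ‖f z‖ ≤ Real.exp (C * (1 + ‖z‖) ^ K)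

namespace FiniteGrowth

variable {f g : ℂ → ℂ}

theorem add (hf : FiniteGrowth f) (hg : FiniteGrowth g) : FiniteGrowth fun z => f z + g z := by
  obtain ⟨C, K, hC, h⟩ := hf
  obtain ⟨D, L, hD, h'⟩ := hg
  refine ⟨C + D + 1, K + L, by positivity, fun z => ?_⟩
  have h1 : 1 ≤ 1 + ‖z‖ := by linarith [norm_nonneg z]
  have hK : (1 + ‖z‖) ^ K ≤ (1 + ‖z‖) ^ (K + L) := pow_le_pow_right₀ h1 (by omega)
  have hL : (1 + ‖z‖) ^ L ≤ (1 + ‖z‖) ^ (K + L) := pow_le_pow_right₀ h1 (by omega)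
  have h0 : 1 ≤ (1 + ‖z‖) ^ (K + L) := one_le_pow₀ h1
  generalize (1 + ‖z‖) ^ (K + L) = X at hK hL h0
  have e1 : Real.exp (C * (1 + ‖z‖) ^ K) ≤ Real.exp ((C + D) * X) := Real.exp_le_exp.2 (by
    nlinarith [mul_le_mul_of_nonneg_left hK hC, mul_nonneg hD (zero_le_one.trans h0)])
  have e2 : Real.exp (D * (1 + ‖z‖) ^ L) ≤ Real.exp ((C + D) * X) := Real.exp_le_exp.2 (by
    nlinarith [mul_le_mul_of_nonneg_left hL hD, mul_nonneg hC (zero_le_one.trans h0)])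
  have e3 : (2 : ℝ) ≤ Real.exp X := by linarith [Real.add_one_le_exp X]
  rw [add_mul _ 1 X, one_mul, Real.exp_add]
  have e4 := Real.exp_pos ((C + D) * X)
  calc ‖f z + g z‖ ≤ ‖f z‖ + ‖g z‖ := norm_add_le _ _
    _ ≤ Real.exp ((C + D) * X) * 2 := by linarith [h z, h' z]
    _ ≤ _ := by gcongr

theorem const_mul (c : ℂ) (hf : FiniteGrowth f) : FiniteGrowth fun z => c * f z := by
  obtain ⟨C, K, hC, h⟩ := hf
  refine ⟨C + ‖c‖, K, by positivity, fun z => ?_⟩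
  have h1 : 1 ≤ (1 + ‖z‖) ^ K := one_le_pow₀ (by linarith [norm_nonneg z])
  rw [norm_mul, add_mul, Real.exp_add, mul_comm]
  have h2 : ‖c‖ ≤ Real.exp (‖c‖ * (1 + ‖z‖) ^ K) := by
    have := Real.add_one_le_exp (‖c‖ * (1 + ‖z‖) ^ K)
    nlinarith [norm_nonneg c]
  exact mul_le_mul (h z) h2 (norm_nonneg _) (Real.exp_pos _).le

theorem sub (hf : FiniteGrowth f) (hg : FiniteGrowth g) : FiniteGrowth fun z => f z - g z := by
  simpa [sub_eq_add_neg] using hf.add (hg.const_mul (-1))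

theorem comp_add (hf : FiniteGrowth f) (b : ℂ) : FiniteGrowth fun z => f (z + b) := by
  obtain ⟨C, K, hC, h⟩ := hf
  refine ⟨C * (1 + ‖b‖) ^ K, K, by positivity, fun z => (h _).trans (Real.exp_le_exp.2 ?_)⟩
  rw [mul_assoc, ← mul_pow]
  gcongr
  nlinarith [norm_add_le z b, norm_nonneg z, norm_nonneg b]

theorem zero : FiniteGrowth fun _ => 0 := ⟨0, 0, le_rfl, fun z => by simp⟩

theorem exp_mul (s : ℂ) : FiniteGrowth fun z => exp (s * z) :=
  ⟨‖s‖, 1, norm_nonneg s, fun z => (Complex.norm_exp_le_exp_norm _).trans (Real.exp_le_exp.2 (by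
    rw [norm_mul, pow_one]; gcongr; linarith))⟩

theorem sum {ι : Type*} (s : Finset ι) {f : ι → ℂ → ℂ} (h : ∀ i ∈ s, FiniteGrowth (f i)) :
    FiniteGrowth fun z => ∑ i ∈ s, f i z := by
  classical
  induction s using Finset.induction_on with
  | empty => simpa using zero
  | insert i s hi ih =>
    simp only [Finset.sum_insert hi]
    exact (h i (by simp)).add (ih fun j hj => h j (by simp [hj]))

end FiniteGrowth

section growthOrder

variable {f : ℂ → ℂ}

theorem norm_le_maxModulus (hf : Continuous f) {z : ℂ} {r : ℝ} (hz : ‖z‖ ≤ r) :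
    ‖f z‖ ≤ maxModulus f r :=
  le_csSup ((isCompact_closedBall (0 : ℂ) r).image hf.norm).bddAbove
    ⟨z, by simpa using hz, rfl⟩

theorem maxModulus_le {r B : ℝ} (hr : 0 ≤ r) (h : ∀ z, ‖z‖ ≤ r → ‖f z‖ ≤ B) :
    maxModulus f r ≤ B := by
  refine csSup_le ⟨‖f 0‖, 0, by simpa using hr, rfl⟩ ?_
  rintro _ ⟨z, hz, rfl⟩
  exact h z (by simpa using hz)

theorem FiniteGrowth.of_growthOrder_lt_top (hf : Continuous f) (h : growthOrder f < ⊤) :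
    FiniteGrowth f := by
  obtain ⟨b, hb1, hb2⟩ := EReal.lt_iff_exists_real_btwn.1 h
  have h1 := eventually_lt_of_limsup_lt hb1
  obtain ⟨R, hR⟩ := eventually_atTop.1 h1
  obtain ⟨K, hK⟩ := exists_nat_ge b
  set R0 := max R 2 with hR0
  have hR2 : 2 ≤ R0 := le_max_right _ _
  have hmax : ∀ r, R0 ≤ r → maxModulus f r ≤ Real.exp (r ^ K) := by
    intro r hr
    have hr1 : 1 < r := by linarith
    have hlog : 0 < Real.log r := Real.log_pos hr1
    have h2 := EReal.coe_lt_coe_iff.1 (hR r ((le_max_left _ _).trans hr))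
    rw [div_lt_iff₀ hlog] at h2
    have hrK : 0 < r ^ K := by positivity
    by_cases hM : maxModulus f r ≤ 1
    · exact hM.trans (Real.one_le_exp hrK.le)
    push Not at hM
    have hl := Real.log_pos hM
    have h3 : Real.log (Real.log (maxModulus f r)) ≤ Real.log (r ^ K) := by
      rw [Real.log_pow]
      exact h2.le.trans (mul_le_mul_of_nonneg_right hK hlog.le)
    rw [← Real.log_le_iff_le_exp (by linarith)]
    exact (Real.log_le_log_iff hl hrK).1 h3
  refine ⟨R0 ^ K, K, by positivity, fun z => ?_⟩
  have hz : ‖z‖ ≤ max ‖z‖ R0 := le_max_left _ _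
  refine (norm_le_maxModulus hf hz).trans ((hmax _ (le_max_right _ _)).trans
    (Real.exp_le_exp.2 ?_))
  rw [← mul_pow]
  have hn := norm_nonneg z
  refine pow_le_pow_left₀ (hn.trans hz) (max_le ?_ ?_) K
  · nlinarith
  · nlinarith

theorem FiniteGrowth.growthOrder_lt_top (hf : Continuous f) (h : FiniteGrowth f) :
    growthOrder f < ⊤ := by
  obtain ⟨C, K, hC, hb⟩ := h
  -- the bound below makes the conventions `log x = log |x|` and `log 0 = 0` harmless
  have key : ∀ᶠ r : ℝ in atTop, |Real.log (maxModulus f r)| ≤ r ^ (K + 1) := by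
    have hup : ∀ᶠ r : ℝ in atTop, maxModulus f r ≤ Real.exp (r ^ (K + 1)) := by
      filter_upwards [eventually_ge_atTop 1, eventually_ge_atTop (C * 2 ^ K)] with r hr hr2
      refine maxModulus_le (by linarith) fun z hz => (hb z).trans (Real.exp_le_exp.2 ?_)
      calc C * (1 + ‖z‖) ^ K ≤ C * (2 * r) ^ K := by
            gcongr; linarith
        _ = C * 2 ^ K * r ^ K := by rw [mul_pow]; ring
        _ ≤ r * r ^ K := by gcongr
        _ = _ := by ring
    by_cases h0 : ∀ z, f z = 0
    · filter_upwards [eventually_ge_atTop 1] with r hr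
      have : maxModulus f r = 0 := by
        refine le_antisymm (maxModulus_le (by linarith) fun z _ => by simp [h0 z]) ?_
        exact (norm_nonneg (f 0)).trans (norm_le_maxModulus hf (by simp; linarith))
      rw [this]; simp; positivity
    · push Not at h0
      obtain ⟨z0, hz0⟩ := h0
      have hp : 0 < ‖f z0‖ := norm_pos_iff.2 hz0
      filter_upwards [hup, eventually_ge_atTop 1, eventually_ge_atTop ‖z0‖,
        eventually_ge_atTop (-Real.log ‖f z0‖)] with r h1 h2 h3 h4
      have h5 := norm_le_maxModulus hf h3
      rw [abs_le]
      constructor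
      · have := Real.log_le_log hp h5
        have h6 : r ≤ r ^ (K + 1) := le_self_pow₀ h2 (by omega)
        linarith
      · rwa [Real.log_le_iff_le_exp (hp.trans_le h5)]
  refine lt_of_le_of_lt (b := (((K + 1 : ℕ) : ℝ) : EReal)) ?_ (EReal.coe_lt_top _)
  refine limsup_le_of_le (by isBoundedDefault) ?_
  filter_upwards [key, eventually_gt_atTop 1] with r h1 h2
  refine EReal.coe_le_coe_iff.2 ?_
  have hlog := Real.log_pos h2
  rw [div_le_iff₀ hlog, ← Real.log_pow, ← Real.log_abs (Real.log _)]
  by_cases h0 : |Real.log (maxModulus f r)| = 0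
  · rw [h0, Real.log_zero]
    exact Real.log_nonneg (one_le_pow₀ h2.le)
  · exact Real.log_le_log (lt_of_le_of_ne (abs_nonneg _) (Ne.symm h0)) h1

end growthOrder

/-! ### Fourier coefficients of solutions that are periodic up to a factor -/

theorem FiniteGrowth.mul {f g : ℂ → ℂ} (hf : FiniteGrowth f) (hg : FiniteGrowth g) :
    FiniteGrowth fun z => f z * g z := by
  obtain ⟨C, K, hC, h⟩ := hf
  obtain ⟨D, L, hD, h'⟩ := hg
  refine ⟨C + D, K + L, by positivity, fun z => ?_⟩
  have h1 : 1 ≤ 1 + ‖z‖ := by linarith [norm_nonneg z]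
  have hK : (1 + ‖z‖) ^ K ≤ (1 + ‖z‖) ^ (K + L) := pow_le_pow_right₀ h1 (by omega)
  have hL : (1 + ‖z‖) ^ L ≤ (1 + ‖z‖) ^ (K + L) := pow_le_pow_right₀ h1 (by omega)
  rw [norm_mul, add_mul, Real.exp_add]
  refine mul_le_mul ((h z).trans (Real.exp_le_exp.2 ?_)) ((h' z).trans (Real.exp_le_exp.2 ?_))
    (norm_nonneg _) (Real.exp_pos _).le <;> gcongr

section periodic

variable {g : ℂ → ℂ}

theorem hasDerivAt_comp_vertical (hg : Differentiable ℂ g) (x t : ℝ) :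
    HasDerivAt (fun t : ℝ => g (x + t * I)) (deriv g (x + t * I) * I) t := by
  have h1 : HasDerivAt (fun t : ℝ => (x : ℂ) + t * I) I t := by
    simpa using ((hasDerivAt_id t).ofReal_comp.mul_const I).const_add (x : ℂ)
  exact (hg _).hasDerivAt.comp t h1

theorem continuous_comp_vertical (hg : Continuous g) (x : ℝ) :
    Continuous fun t : ℝ => g (x + t * I) := by fun_prop

theorem integral_deriv_eq_zero (hg : Differentiable ℂ g)
    (hp : ∀ z, g (z + Real.pi * I) = g z) (x : ℝ) :
    ∫ t in (0 : ℝ)..Real.pi, deriv g (x + t * I) = 0 := by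
  have hc := continuous_comp_vertical (differentiable_deriv hg).continuous x
  have h := intervalIntegral.integral_eq_sub_of_hasDerivAt (a := 0) (b := Real.pi)
    (fun t _ => hasDerivAt_comp_vertical hg x t) ((hc.mul continuous_const).intervalIntegrable _ _)
  rw [hp, intervalIntegral.integral_mul_const] at h
  simpa using h

theorem integral_vertical_eq (hg : Differentiable ℂ g)
    (hp : ∀ z, g (z + Real.pi * I) = g z) (x y : ℝ) :
    ∫ t in (0 : ℝ)..Real.pi, g (x + t * I) = ∫ t in (0 : ℝ)..Real.pi, g (y + t * I) := by
  have h := Complex.integral_boundary_rect_eq_zero_of_differentiableOn g x (y + Real.pi * I)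
    hg.differentiableOn
  simp only [ofReal_re, ofReal_im, add_re, mul_re, I_re, mul_zero, I_im, mul_one, sub_self,
    add_zero, add_im, mul_im, zero_add, ofReal_zero, zero_mul, hp, smul_eq_mul] at h
  rw [← mul_sub] at h
  exact (sub_eq_zero.1 ((mul_eq_zero.1 h).resolve_left I_ne_zero)).symm

/-- The Fourier coefficient (up to the factor `π`) of index `k` of the `πi`-periodic function `g`,
computed on the line `Re z = x`. -/
noncomputable def mode (g : ℂ → ℂ) (k : ℤ) (x : ℝ) : ℂ :=
  ∫ t in (0 : ℝ)..Real.pi, g (x + t * I) * exp (-(2 * k) * (x + t * I))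

theorem exp_two_int_mul_add (k : ℤ) (z : ℂ) :
    exp (-(2 * k) * (z + Real.pi * I)) = exp (-(2 * k) * z) := by
  rw [mul_add, Complex.exp_add]
  have : exp (-(2 * (k : ℂ)) * (Real.pi * I)) = 1 := by
    rw [Complex.exp_eq_one_iff]; exact ⟨-k, by push_cast; ring⟩
  rw [this, mul_one]

/-- The coefficient does not depend on the line, by Cauchy's theorem on a rectangle. -/
theorem mode_eq (hg : Differentiable ℂ g) (hp : ∀ z, g (z + Real.pi * I) = g z) (k : ℤ) (x y : ℝ) :
    mode g k x = mode g k y :=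
  integral_vertical_eq (g := fun z => g z * exp (-(2 * k) * z)) (by fun_prop)
    (fun z => by simp only [hp, exp_two_int_mul_add]) x y

/-- Every line gives a bound, so the index can be traded against the growth by choosing `x`. -/
theorem norm_mode_le {C : ℝ} {K : ℕ} (hC : 0 ≤ C) (h : ∀ z, ‖g z‖ ≤ Real.exp (C * (1 + ‖z‖) ^ K))
    (k : ℤ) (x : ℝ) :
    ‖mode g k x‖ ≤ Real.pi * Real.exp (C * (5 + |x|) ^ K - 2 * k * x) := by
  have hpi := Real.pi_pos
  have hb : ∀ t ∈ Set.uIoc (0 : ℝ) Real.pi, ‖g (x + t * I) * exp (-(2 * k) * (x + t * I))‖ ≤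
      Real.exp (C * (5 + |x|) ^ K - 2 * k * x) := by
    intro t ht
    rw [Set.uIoc_of_le hpi.le] at ht
    rw [norm_mul, sub_eq_add_neg, Real.exp_add, Complex.norm_exp]
    have hn : ‖(x : ℂ) + t * I‖ ≤ |x| + 4 := by
      refine (norm_add_le _ _).trans ?_
      rw [norm_mul, norm_I, mul_one, Complex.norm_real, Complex.norm_real, Real.norm_eq_abs,
        Real.norm_eq_abs, abs_of_pos ht.1]
      linarith [ht.2, Real.pi_le_four]
    refine mul_le_mul ((h _).trans (Real.exp_le_exp.2 ?_)) (Real.exp_le_exp.2 (le_of_eq ?_))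
      (Real.exp_pos _).le (Real.exp_pos _).le
    · exact mul_le_mul_of_nonneg_left
        (pow_le_pow_left₀ (by positivity) (by linarith) _) hC
    · simp
  have := intervalIntegral.norm_integral_le_of_norm_le_const hb
  rw [sub_zero, abs_of_pos hpi] at this
  exact this.trans_eq (mul_comm _ _)

/-- A `πi`-periodic entire function with vanishing Fourier coefficients is zero. -/
theorem eq_zero_of_mode_eq_zero (hg : Continuous g) (hp : ∀ z, g (z + Real.pi * I) = g z)
    (h0 : ∀ k x, mode g k x = 0) (z : ℂ) : g z = 0 := by
  have : Fact (0 < Real.pi) := ⟨Real.pi_pos⟩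
  set f : ℝ → ℂ := fun t => g (z.re + t * I) with hf
  have hfp : Function.Periodic f Real.pi := fun t => by
    simp only [hf]
    rw [← hp (z.re + t * I)]; push_cast; ring_nf
  have hfc : Continuous f := continuous_comp_vertical hg z.re
  let F : C(AddCircle Real.pi, ℂ) := ⟨hfp.lift, continuous_coinduced_dom.mpr hfc⟩
  have hF : ∀ t : ℝ, F (t : AddCircle Real.pi) = f t := fun t => hfp.lift_coe t
  have hcoef : ∀ k : ℤ, fourierCoeff F k = 0 := by
    intro k
    rw [fourierCoeff_eq_intervalIntegral F k 0, zero_add]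
    have e : ∀ t : ℝ, @fourier Real.pi (-k) (t : AddCircle Real.pi) • F (t : AddCircle Real.pi) =
        exp (2 * k * z.re) * (g (z.re + t * I) * exp (-(2 * k) * (z.re + t * I))) := by
      intro t
      rw [hF, fourier_coe_apply, smul_eq_mul, mul_left_comm, ← Complex.exp_add, mul_comm]
      congr 2
      have : (Real.pi : ℂ) ≠ 0 := ofReal_ne_zero.2 Real.pi_ne_zero
      push_cast
      field_simp
      ring
    simp only [e]
    rw [intervalIntegral.integral_const_mul]
    have := h0 k z.re
    rw [mode] at this
    rw [this, mul_zero, smul_zero]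
  have hs := has_pointwise_sum_fourier_series_of_summable (f := F)
    (by simpa only [funext hcoef] using summable_zero) (z.im : AddCircle Real.pi)
  simp only [hcoef, zero_smul, hF] at hs
  have := hs.unique hasSum_zero
  simpa [hf, re_add_im] using this

end periodic

section recurrence

variable {a ν : ℂ} {h : ℤ → ℂ}

theorem eventually_log_pow_le {C : ℝ} (hC : 0 ≤ C) (K : ℕ) :
    ∀ᶠ X : ℝ in atTop, C * (5 + 2 * Real.log X) ^ K ≤ X := by
  have h1 := (Real.isLittleO_pow_log_id_atTop (n := K)).def
    (c := 1 / (C * 3 ^ K + 1)) (by positivity)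
  filter_upwards [h1, eventually_ge_atTop 1,
    Real.tendsto_log_atTop.eventually_ge_atTop 5] with X hX hX1 hL
  have hL0 : 0 ≤ Real.log X := by linarith
  rw [Real.norm_of_nonneg (by positivity), id, Real.norm_of_nonneg (by linarith),
    one_div, inv_mul_eq_div, le_div_iff₀ (by positivity)] at hX
  calc C * (5 + 2 * Real.log X) ^ K ≤ C * (3 * Real.log X) ^ K := by gcongr; linarith
    _ = Real.log X ^ K * (C * 3 ^ K) := by rw [mul_pow]; ring
    _ ≤ Real.log X ^ K * (C * 3 ^ K + 1) := by gcongr; linarith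
    _ ≤ X := hX

/-- Fourier coefficients satisfying the homogeneous recurrence for positive index decay no faster
than `(k!)⁻²`; this is incompatible with finite order unless they vanish. -/
theorem eq_zero_of_recurrence
    (hrec : ∀ k : ℤ, 1 ≤ k → ((a + 2 * k) ^ 2 - ν ^ 2) * h k + h (k - 1) = 0)
    {C : ℝ} {K : ℕ} (hC : 0 ≤ C)
    (hb : ∀ (k : ℤ) (x : ℝ), ‖h k‖ ≤ Real.pi * Real.exp (C * (5 + |x|) ^ K - 2 * k * x))
    (N : ℕ) : h N = 0 := by
  set S : ℝ := ‖a‖ + ‖ν‖ + 1 with hS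
  have hS1 : 1 ≤ S := by rw [hS]; linarith [norm_nonneg a, norm_nonneg ν]
  have hstep : ∀ k : ℕ, ‖h k‖ ≤ (S + 2 * (k + 1)) ^ 2 * ‖h (k + 1)‖ := by
    intro k
    have e := hrec (k + 1) (by omega)
    rw [add_sub_cancel_right, add_comm, ← eq_neg_iff_add_eq_zero] at e
    rw [e, norm_neg, norm_mul]
    gcongr
    calc ‖(a + 2 * ((k + 1 : ℤ) : ℂ)) ^ 2 - ν ^ 2‖
        ≤ ‖a + 2 * ((k + 1 : ℤ) : ℂ)‖ ^ 2 + ‖ν‖ ^ 2 := by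
          refine (norm_sub_le _ _).trans ?_; rw [norm_pow, norm_pow]
      _ ≤ (‖a‖ + 2 * (k + 1)) ^ 2 + ‖ν‖ ^ 2 := by
          gcongr
          refine (norm_add_le _ _).trans ?_
          rw [norm_mul]
          have : ‖((k + 1 : ℤ) : ℂ)‖ = k + 1 := by
            have := Complex.norm_natCast (k + 1); push_cast at this ⊢; exact this
          rw [this]; simp
      _ ≤ _ := by
          have h1 := norm_nonneg a
          have h2 := norm_nonneg ν
          have h3 : (0 : ℝ) ≤ k := Nat.cast_nonneg k
          rw [hS]
          nlinarith [mul_nonneg h1 h2, mul_nonneg h2 h3]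
  have hiter : ∀ d : ℕ, ‖h N‖ ≤ (S + 2 * (N + d)) ^ (2 * d) * ‖h (N + d)‖ := by
    intro d
    induction d with
    | zero => simp
    | succ d ih =>
      have h1 := hstep (N + d)
      push_cast at h1 ⊢
      rw [add_assoc (N : ℤ) d 1] at h1
      calc ‖h N‖ ≤ (S + 2 * (N + d)) ^ (2 * d) * ‖h (N + d)‖ := ih
        _ ≤ (S + 2 * (N + (d + 1))) ^ (2 * d) *
            ((S + 2 * (N + d + 1)) ^ 2 * ‖h (N + (d + 1))‖) := by gcongr; linarith
        _ = _ := by rw [mul_add 2 d 1, pow_add]; ring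
  have ht : Tendsto (fun d : ℕ => S + 2 * ((N : ℝ) + d)) atTop atTop := by
    refine tendsto_atTop_add_const_left _ _ (Tendsto.const_mul_atTop two_pos ?_)
    exact tendsto_atTop_add_const_left _ _ tendsto_natCast_atTop_atTop
  have hlim : Tendsto (fun d : ℕ => Real.pi * Real.exp (2 * S - (S + 2 * ((N : ℝ) + d))))
      atTop (𝓝 0) := by
    have : Tendsto (fun d : ℕ => 2 * S - (S + 2 * ((N : ℝ) + d))) atTop atBot := by
      have := tendsto_atBot_add_const_left atTop (2 * S) (tendsto_neg_atTop_atBot.comp ht)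
      simpa [sub_eq_add_neg, Function.comp_def] using this
    simpa using (Real.tendsto_exp_atBot.comp this).const_mul Real.pi
  rw [← norm_le_zero_iff]
  refine ge_of_tendsto hlim ?_
  filter_upwards [ht.eventually (eventually_log_pow_le hC K),
    ht.eventually (Real.tendsto_log_atTop.eventually_ge_atTop 2)] with d hd1 hd2
  set X : ℝ := S + 2 * ((N : ℝ) + d) with hX
  have hX1 : 1 ≤ X := by
    have : (0 : ℝ) ≤ N + d := by positivity
    linarith
  have hXp : 0 < X := by linarith
  -- on the line `x = 2 log X` the factor `e^{-2kx} = X^{-4k}` beats the growth `X^{2k}`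
  have hb1 := hb (N + d) (2 * Real.log X)
  rw [abs_of_nonneg (by linarith)] at hb1
  have hpow : X ^ (2 * d) ≤ Real.exp ((X - S) * Real.log X) := by
    rw [← Real.rpow_natCast, Real.rpow_def_of_pos hXp, mul_comm]
    refine Real.exp_le_exp.2 (mul_le_mul_of_nonneg_right ?_ (by linarith))
    have : (0 : ℝ) ≤ N := Nat.cast_nonneg N
    rw [hX]; push_cast; linarith
  calc ‖h N‖ ≤ X ^ (2 * d) * ‖h (N + d)‖ := hiter d
    _ ≤ Real.exp ((X - S) * Real.log X) * (Real.pi *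
        Real.exp (C * (5 + 2 * Real.log X) ^ K - 2 * ((N + d : ℤ) : ℝ) * (2 * Real.log X))) := by
      gcongr
    _ = Real.pi * Real.exp (C * (5 + 2 * Real.log X) ^ K - (X - S) * Real.log X) := by
      rw [mul_left_comm, ← Real.exp_add]
      congr 2
      rw [hX]; push_cast; ring
    _ ≤ Real.pi * Real.exp (2 * S - X) := by
      have hXS : 0 ≤ X - S := by
        have : (0 : ℝ) ≤ N + d := by positivity
        linarith
      have h3 : 2 * (X - S) ≤ (X - S) * Real.log X := by nlinarith
      refine mul_le_mul_of_nonneg_left (Real.exp_le_exp.2 ?_) Real.pi_pos.le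
      linarith

/-- Fourier coefficients satisfying the recurrence for negative index grow factorially, unless they
terminate. -/
theorem exists_eq_zero_of_recurrence
    (hrec : ∀ k : ℤ, k ≤ -1 → ((a + 2 * k) ^ 2 - ν ^ 2) * h k + h (k - 1) = 0)
    {B : ℝ} (hb : ∀ k : ℤ, ‖h k‖ ≤ B * Real.exp (2 * k)) :
    ∃ n : ℕ, 1 ≤ n ∧ h (-n) = 0 := by
  by_contra! hne
  obtain ⟨n0, hn0⟩ := exists_nat_ge (‖a‖ + ‖ν‖ + 1)
  have hn1 : 1 ≤ n0 := by
    have : (1 : ℝ) ≤ n0 := by linarith [norm_nonneg a, norm_nonneg ν]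
    exact_mod_cast this
  have hmono : ∀ d : ℕ, ‖h (-(n0 : ℤ))‖ ≤ ‖h (-((n0 + d : ℕ) : ℤ))‖ := by
    intro d
    induction d with
    | zero => simp
    | succ d ih =>
      refine ih.trans ?_
      have e := hrec (-((n0 + d : ℕ) : ℤ)) (by omega)
      rw [add_comm, ← eq_neg_iff_add_eq_zero,
        show -((n0 + d : ℕ) : ℤ) - 1 = -((n0 + (d + 1) : ℕ) : ℤ) by push_cast; ring] at e
      rw [e, norm_neg, norm_mul]
      refine le_mul_of_one_le_left (norm_nonneg _) ?_
      have e2 : (a + 2 * ((-((n0 + d : ℕ) : ℤ) : ℤ) : ℂ)) ^ 2 - ν ^ 2 =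
          (-a - ν + (2 * (n0 + d) : ℕ)) * (-a + ν + (2 * (n0 + d) : ℕ)) := by push_cast; ring
      rw [e2, norm_mul]
      have g1 := norm_add_natCast_ge (-a - ν) (2 * (n0 + d))
      have g2 := norm_add_natCast_ge (-a + ν) (2 * (n0 + d))
      have g3 := norm_sub_le (-a) ν
      have g4 := norm_add_le (-a) ν
      rw [norm_neg] at g3 g4
      have g5 : (0 : ℝ) ≤ d := Nat.cast_nonneg d
      refine one_le_mul_of_one_le_of_one_le ?_ ?_
      · refine le_trans ?_ g1; push_cast; linarith
      · refine le_trans ?_ g2; push_cast; linarith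
  have hlim : Tendsto (fun d : ℕ => B * Real.exp (2 * ((-((n0 + d : ℕ) : ℤ) : ℤ) : ℝ)))
      atTop (𝓝 0) := by
    have : Tendsto (fun d : ℕ => 2 * ((-((n0 + d : ℕ) : ℤ) : ℤ) : ℝ)) atTop atBot := by
      refine Tendsto.const_mul_atBot two_pos ?_
      simp only [Int.cast_neg, Int.cast_natCast]
      refine tendsto_neg_atTop_atBot.comp (tendsto_natCast_atTop_atTop.comp ?_)
      exact tendsto_atTop_mono (fun d => Nat.le_add_left d n0) tendsto_id
    simpa using (Real.tendsto_exp_atBot.comp this).const_mul B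
  have := ge_of_tendsto' hlim fun d => (hmono d).trans (hb _)
  exact hne n0 hn1 (norm_le_zero_iff.1 this)

end recurrence

section equation

variable {a ν c : ℂ} {y : ℂ → ℂ}

/-- The Fourier coefficients of `e^{-az} y` inherit a two-term recurrence from the equation. -/
theorem mode_recurrence (hy : SolvesBessel 1 ν (fun z => c * exp (a * z)) y)
    (hp : ∀ z, y (z + Real.pi * I) = exp (a * (Real.pi * I)) * y z) (k : ℤ) (x : ℝ) :
    ((a + 2 * k) ^ 2 - ν ^ 2) * mode (fun z => y z * exp (-a * z)) k x
      + mode (fun z => y z * exp (-a * z)) (k - 1) x = if k = 0 then c * Real.pi else 0 := by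
  set s : ℂ := a + 2 * k with hs
  have hyd := hy.differentiable
  have hyd' := differentiable_deriv hyd
  have hE : ∀ c z : ℂ, HasDerivAt (fun z => exp (c * z)) (c * exp (c * z)) z := fun c z => by
    simpa [mul_comm] using ((hasDerivAt_id z).const_mul c).cexp
  have hp' : ∀ z, deriv y (z + Real.pi * I) = exp (a * (Real.pi * I)) * deriv y z := by
    intro z
    rw [← deriv_comp_add_const, funext hp, deriv_const_mul _ (hyd z)]
  set G : ℂ → ℂ := fun z => (deriv y z + s * y z) * exp (-s * z) with hG
  have hGd : ∀ z, HasDerivAt G ((deriv (deriv y) z - s ^ 2 * y z) * exp (-s * z)) z := by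
    intro z
    refine (((hyd' z).hasDerivAt.add ((hyd z).hasDerivAt.const_mul s)).mul (hE (-s) z)).congr_deriv
      ?_
    simp only [Pi.add_apply]
    ring
  have hGp : ∀ z, G (z + Real.pi * I) = G z := by
    intro z
    simp only [hG]
    rw [hp, hp', show -s * (z + Real.pi * I) = -(2 * k) * (z + Real.pi * I) - a * z
      - a * (Real.pi * I) by rw [hs]; ring, Complex.exp_sub, Complex.exp_sub, exp_two_int_mul_add,
      show -s * z = -(2 * k) * z - a * z by rw [hs]; ring, Complex.exp_sub]
    have := Complex.exp_ne_zero (a * (Real.pi * I))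
    field_simp
  have h0 := integral_deriv_eq_zero (fun z => (hGd z).differentiableAt) hGp x
  have hyc := hyd.continuous
  have e1 : ∀ z, deriv G z = c * exp (-(2 * k) * z)
      - (s ^ 2 - ν ^ 2) * (y z * exp (-a * z) * exp (-(2 * k) * z))
      - y z * exp (-a * z) * exp (-(2 * (k - 1 : ℤ)) * z) := by
    intro z
    rw [(hGd z).deriv, show deriv (deriv y) z = c * exp (a * z) - (1 * exp (2 * z) - ν ^ 2) * y z
      by rw [← hy.eq z]; ring]
    have x1 : exp (-(2 * k) * z) = exp (a * z) * exp (-s * z) := by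
      rw [← Complex.exp_add, hs]; ring_nf
    have x2 : exp (-(2 * (k - 1 : ℤ)) * z) = exp (2 * z) * exp (a * z) * exp (-s * z) := by
      rw [← Complex.exp_add, ← Complex.exp_add, hs]; push_cast; ring_nf
    have x3 : exp (-a * z) * exp (a * z) = 1 := by
      rw [← Complex.exp_add]; simp
    rw [x1, x2]
    linear_combination ((s ^ 2 - ν ^ 2) * y z * exp (-s * z)
      + y z * exp (2 * z) * exp (-s * z)) * x3
  simp only [e1] at h0
  rw [intervalIntegral.integral_sub (Continuous.intervalIntegrable (by fun_prop) _ _)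
      (Continuous.intervalIntegrable (by fun_prop) _ _),
    intervalIntegral.integral_sub (Continuous.intervalIntegrable (by fun_prop) _ _)
      (Continuous.intervalIntegrable (by fun_prop) _ _),
    intervalIntegral.integral_const_mul, intervalIntegral.integral_const_mul] at h0
  have h1 : ∫ t in (0 : ℝ)..Real.pi, exp (-(2 * k) * (x + t * I)) =
      if k = 0 then (Real.pi : ℂ) else 0 := by
    split_ifs with hk
    · simp [hk]
    · have hk' : (-(2 * k) : ℂ) ≠ 0 := by simpa using hk
      have := integral_deriv_eq_zero (g := fun z => (-(2 * k) : ℂ)⁻¹ * exp (-(2 * k) * z))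
        (by fun_prop) (fun z => by simp only [exp_two_int_mul_add]) x
      rw [← this]
      congr 1
      ext t
      rw [((hE (-(2 * k)) _).const_mul _).deriv, inv_mul_cancel_left₀ hk']
  rw [h1] at h0
  have h2 : (if k = 0 then c * (Real.pi : ℂ) else 0) = c * if k = 0 then (Real.pi : ℂ) else 0 := by
    split_ifs <;> simp
  rw [h2]
  simp only [mode]
  linear_combination -h0

theorem twisted_periodic (hp : ∀ z, y (z + Real.pi * I) = exp (a * (Real.pi * I)) * y z) (z : ℂ) :
    y (z + Real.pi * I) * exp (-a * (z + Real.pi * I)) = y z * exp (-a * z) := by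
  rw [hp, mul_add, Complex.exp_add, neg_mul a (Real.pi * I), Complex.exp_neg]
  field_simp [Complex.exp_ne_zero (a * (Real.pi * I))]

/-- The equation without right-hand side has no nonzero solution of finite order that is
multiplied by a constant under `z ↦ z + πi`. -/
theorem eq_zero_of_periodic (hy : SolvesBessel 1 ν (fun _ => 0) y)
    (hp : ∀ z, y (z + Real.pi * I) = exp (a * (Real.pi * I)) * y z) (hg : FiniteGrowth y) (z : ℂ) :
    y z = 0 := by
  have hd := hy.differentiable
  have hq := twisted_periodic hp
  have hqd : Differentiable ℂ fun z => y z * exp (-a * z) := by fun_prop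
  obtain ⟨C, K, hC, hb⟩ := hg.mul (FiniteGrowth.exp_mul (-a))
  have hrec : ∀ k : ℤ, ((a + 2 * k) ^ 2 - ν ^ 2) * mode (fun z => y z * exp (-a * z)) k 0
      + mode (fun z => y z * exp (-a * z)) (k - 1) 0 = 0 := fun k => by
    rw [mode_recurrence (c := 0) (hy.congr (fun _ => rfl) fun z => by simp) hp]; simp
  have hpos : ∀ n : ℕ, mode (fun z => y z * exp (-a * z)) n 0 = 0 :=
    eq_zero_of_recurrence (h := fun k => mode (fun z => y z * exp (-a * z)) k 0)
      (fun k _ => hrec k) hC fun k x => by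
        rw [mode_eq hqd hq k 0 x]; exact norm_mode_le hC hb k x
  have hneg : ∀ n : ℕ, mode (fun z => y z * exp (-a * z)) (-n) 0 = 0 := by
    intro n
    induction n with
    | zero => exact hpos 0
    | succ n ih =>
      have := hrec (-n)
      rw [ih, mul_zero, zero_add, show -(n : ℤ) - 1 = -((n + 1 : ℕ) : ℤ) by push_cast; ring] at this
      exact this
  have hall : ∀ k x, mode (fun z => y z * exp (-a * z)) k x = 0 := by
    intro k x
    rw [mode_eq hqd hq k x 0]
    obtain ⟨n, rfl | rfl⟩ := k.eq_nat_or_neg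
    · exact hpos n
    · exact hneg n
  have := eq_zero_of_mode_eq_zero hqd.continuous hq hall z
  exact (mul_eq_zero.1 this).resolve_right (Complex.exp_ne_zero _)

/-- If the equation with right-hand side `e^{az}` has a solution of finite order that is multiplied
by `e^{πia}` under `z ↦ z + πi`, the descending series `ζ^{a-2} - ...` terminates. -/
theorem exists_sq_eq_of_periodic (hy : SolvesBessel 1 ν (fun z => exp (a * z)) y)
    (hp : ∀ z, y (z + Real.pi * I) = exp (a * (Real.pi * I)) * y z) (hg : FiniteGrowth y) :
    ∃ j : ℕ, 1 ≤ j ∧ (a - 2 * j) ^ 2 - ν ^ 2 = 0 := by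
  have hd := hy.differentiable
  have hq := twisted_periodic hp
  have hqd : Differentiable ℂ fun z => y z * exp (-a * z) := by fun_prop
  obtain ⟨C, K, hC, hb⟩ := hg.mul (FiniteGrowth.exp_mul (-a))
  set h : ℤ → ℂ := fun k => mode (fun z => y z * exp (-a * z)) k 0 with hh
  have hrec : ∀ k : ℤ, ((a + 2 * k) ^ 2 - ν ^ 2) * h k + h (k - 1) =
      if k = 0 then (Real.pi : ℂ) else 0 := fun k => by
    simp only [hh]
    rw [mode_recurrence (c := 1) (hy.congr (fun _ => rfl) fun z => by simp) hp, one_mul]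
  have hbd : ∀ k x, ‖h k‖ ≤ Real.pi * Real.exp (C * (5 + |x|) ^ K - 2 * k * x) := fun k x => by
    simp only [hh]
    rw [mode_eq hqd hq k 0 x]; exact norm_mode_le hC hb k x
  have hpos : ∀ n : ℕ, h n = 0 := eq_zero_of_recurrence
    (fun k hk => by rw [hrec, if_neg (by omega)]) hC hbd
  have h1 : h (-1) = Real.pi := by
    have := hrec 0
    have h0 : h 0 = 0 := hpos 0
    rw [if_pos rfl, h0, mul_zero, zero_add, zero_sub] at this
    exact this
  have hex := exists_eq_zero_of_recurrence (B := Real.pi * Real.exp (C * 6 ^ K))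
    (fun k hk => by rw [hrec, if_neg (by omega)]) (fun k => by
      refine (hbd k (-1)).trans (le_of_eq ?_)
      rw [mul_assoc Real.pi, ← Real.exp_add]
      norm_num)
  classical
  have hspec := Nat.find_spec hex
  have hmin := fun m => Nat.find_min (H := hex) (m := m)
  obtain ⟨n, hn⟩ : ∃ n, Nat.find hex = n + 1 := ⟨Nat.find hex - 1, by omega⟩
  rw [hn] at hspec hmin
  rcases Nat.eq_zero_or_pos n with rfl | hnpos
  · exfalso
    have := hspec.2
    simp only [zero_add, Nat.cast_one] at this
    rw [h1] at this
    exact ofReal_ne_zero.2 Real.pi_ne_zero this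
  · refine ⟨n, hnpos, ?_⟩
    have h2 : h (-n) ≠ 0 := fun e => hmin n (by omega) ⟨hnpos, e⟩
    have h3 := hrec (-n)
    rw [if_neg (by omega), show -(n : ℤ) - 1 = -((n + 1 : ℕ) : ℤ) by push_cast; ring, hspec.2,
      add_zero] at h3
    have h4 := (mul_eq_zero.1 h3).resolve_right h2
    push_cast at h4
    linear_combination h4

end equation

/-! ### Uniqueness, and the terminating case -/

section uniqueness

variable {a ν : ℂ} {y y₁ y₂ : ℂ → ℂ}

/-- A solution without right-hand side is determined by its value and derivative at `0`: otherwise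
`y''` and `(e^{2z} - ν²) y` would vanish to different orders there. -/
theorem eq_zero_of_initial (hy : SolvesBessel 1 ν (fun _ => 0) y) (h0 : y 0 = 0)
    (h1 : deriv y 0 = 0) : y = 0 := by
  have hd := hy.differentiable
  have hA : AnalyticAt ℂ y 0 := hd.analyticAt 0
  have hA1 : AnalyticAt ℂ (deriv y) 0 := hA.deriv
  have hq : AnalyticAt ℂ (fun z : ℂ => -(1 * exp (2 * z) - ν ^ 2)) 0 :=
    (show Differentiable ℂ (fun z : ℂ => -(1 * exp (2 * z) - ν ^ 2)) by fun_prop).analyticAt 0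
  have o1 := hA.analyticOrderAt_deriv_add_one
  have o2 := hA1.analyticOrderAt_deriv_add_one
  simp only [h0, h1, sub_zero] at o1 o2
  have e : deriv (deriv y) = (fun z : ℂ => -(1 * exp (2 * z) - ν ^ 2)) * y := by
    funext z
    simp only [Pi.mul_apply]
    linear_combination hy.eq z
  rw [e, analyticOrderAt_mul hq hA] at o2
  have htop : analyticOrderAt y 0 = ⊤ := by
    by_contra hne
    obtain ⟨n, hn⟩ := ENat.ne_top_iff_exists.1 hne
    rw [← o2, ← hn] at o1
    generalize analyticOrderAt (fun z : ℂ => -(1 * exp (2 * z) - ν ^ 2)) 0 = q at o1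
    induction q using ENat.recTopCoe with
    | top => simp at o1
    | coe q =>
      norm_cast at o1
      omega
  rw [analyticOrderAt_eq_top] at htop
  have hU : AnalyticOnNhd ℂ y Set.univ := fun z _ => hd.analyticAt z
  have hU0 : AnalyticOnNhd ℂ (0 : ℂ → ℂ) Set.univ := fun z _ => analyticAt_const
  exact hU.eq_of_eventuallyEq hU0 (z₀ := 0) htop

/-- The space of solutions of finite order of the equation without right-hand side. -/
def finiteGrowthSolutions (ν : ℂ) : Submodule ℂ (ℂ → ℂ) where
  carrier := {y | SolvesBessel 1 ν (fun _ => 0) y ∧ FiniteGrowth y}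
  add_mem' hf hg := ⟨(hf.1.add hg.1).congr (fun _ => rfl) (fun _ => by simp), hf.2.add hg.2⟩
  zero_mem' := ⟨⟨differentiable_const 0, fun z => by
    have : deriv (0 : ℂ → ℂ) = fun _ => 0 := funext fun z => deriv_const z 0
    rw [this]; simp⟩, FiniteGrowth.zero⟩
  smul_mem' c _ hf := ⟨(hf.1.const_mul c).congr (fun _ => rfl) (fun _ => by simp), hf.2.const_mul c⟩

theorem shift_mem {y : ℂ → ℂ} (h : y ∈ finiteGrowthSolutions ν) :
    (fun z => y (z + Real.pi * I)) ∈ finiteGrowthSolutions ν :=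
  ⟨h.1.comp_add (by rw [show (2 : ℂ) * (Real.pi * I) = 2 * Real.pi * I by ring, exp_two_pi_mul_I,
    mul_one]), h.2.comp_add _⟩

/-- The translation by `πi`, which preserves the equation because `e^{2z}` has period `πi`. -/
noncomputable def shift (ν : ℂ) : Module.End ℂ (finiteGrowthSolutions ν) where
  toFun y := ⟨fun z => (y : ℂ → ℂ) (z + Real.pi * I), shift_mem y.2⟩
  map_add' _ _ := rfl
  map_smul' _ _ := rfl

/-- Value and derivative at `0`. -/
noncomputable def initialData (ν : ℂ) : finiteGrowthSolutions ν →ₗ[ℂ] ℂ × ℂ where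
  toFun y := ((y : ℂ → ℂ) 0, deriv (y : ℂ → ℂ) 0)
  map_add' f g := by
    have := deriv_add (f.2.1.differentiable 0) (g.2.1.differentiable 0)
    exact Prod.ext rfl this
  map_smul' c f := by
    have := deriv_const_smul c (f.2.1.differentiable 0)
    exact Prod.ext rfl this

/-- The translation by `πi` would have an eigenvector in a nonzero space of solutions of finite
order, which `eq_zero_of_periodic` excludes. -/
theorem eq_zero_of_finiteGrowth (hy : SolvesBessel 1 ν (fun _ => 0) y) (hg : FiniteGrowth y) :
    y = 0 := by
  have hinj : Function.Injective (initialData ν) := by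
    rw [injective_iff_map_eq_zero]
    intro f hf
    have h := Prod.ext_iff.1 hf
    exact Subtype.ext (eq_zero_of_initial f.2.1 h.1 h.2)
  have : FiniteDimensional ℂ (finiteGrowthSolutions ν) :=
    FiniteDimensional.of_injective (initialData ν) hinj
  by_contra hne
  have : Nontrivial (finiteGrowthSolutions ν) :=
    ⟨⟨⟨y, hy, hg⟩, 0, fun h => hne (congrArg Subtype.val h)⟩⟩
  obtain ⟨l, hl⟩ := Module.End.exists_eigenvalue (shift ν)
  obtain ⟨v, hv⟩ := hl.exists_hasEigenvector
  have hv1 : ∀ z, (v : ℂ → ℂ) (z + Real.pi * I) = l * (v : ℂ → ℂ) z := fun z =>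
    congrFun (congrArg Subtype.val hv.apply_eq_smul) z
  have hl0 : l ≠ 0 := by
    rintro rfl
    refine hv.2 (Subtype.ext (funext fun z => ?_))
    have := hv1 (z - Real.pi * I)
    rw [sub_add_cancel, zero_mul] at this
    exact this
  refine hv.2 (Subtype.ext (funext fun z => ?_))
  refine eq_zero_of_periodic (a := log l / (Real.pi * I)) v.2.1 (fun z => ?_) v.2.2 z
  have hpi : (Real.pi * I : ℂ) ≠ 0 := mul_ne_zero (ofReal_ne_zero.2 Real.pi_ne_zero) I_ne_zero
  rw [div_mul_cancel₀ _ hpi, exp_log hl0, hv1]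

theorem eq_of_finiteGrowth {r : ℂ → ℂ} (h₁ : SolvesBessel 1 ν r y₁) (h₂ : SolvesBessel 1 ν r y₂)
    (hg₁ : FiniteGrowth y₁) (hg₂ : FiniteGrowth y₂) (z : ℂ) : y₁ z = y₂ z := by
  have h := eq_zero_of_finiteGrowth ((h₁.sub h₂).congr (fun _ => rfl) fun _ => (sub_self _).symm)
    (hg₁.sub hg₂)
  exact sub_eq_zero.1 (congrFun h z)

theorem exists_sq_eq_of_finiteGrowth (hy : SolvesBessel 1 ν (fun z => exp (a * z)) y)
    (hg : FiniteGrowth y) : ∃ j : ℕ, 1 ≤ j ∧ (a - 2 * j) ^ 2 - ν ^ 2 = 0 := by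
  refine exists_sq_eq_of_periodic hy (fun z => ?_) hg
  refine eq_of_finiteGrowth (hy.comp_add (b := Real.pi * I) (κ' := 1) ?_)
    ((hy.const_mul (exp (a * (Real.pi * I)))).congr (fun _ => rfl) fun z => ?_)
    (hg.comp_add _) (hg.const_mul _) z
  · rw [show (2 : ℂ) * (Real.pi * I) = 2 * Real.pi * I by ring, exp_two_pi_mul_I, mul_one]
  · simp only [mul_add, Complex.exp_add]; ring

end uniqueness

section descending

variable {μ ν : ℂ} {p : ℕ}

theorem coeff_succ (μ ν : ℂ) (k : ℕ) :
    coeff μ ν (k + 1) = coeff μ ν k * ((μ - 2 * ((k + 1 : ℕ) : ℂ) + 1) ^ 2 - ν ^ 2) := by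
  rw [coeff, coeff, Finset.prod_Icc_succ_top (by omega)]

/-- Truncating the descending series after index `p` leaves one extra term on the right. -/
theorem solvesBessel_descending_aux (μ ν : ℂ) (p : ℕ) :
    SolvesBessel 1 ν
      (fun z => exp ((μ + 1) * z) + (-1) ^ p * coeff μ ν (p + 1) * exp ((μ - 1 - 2 * p) * z))
      (fun z => ∑ k ∈ Finset.range (p + 1),
        (-1) ^ k * coeff μ ν k * exp ((μ - 1 - 2 * k) * z)) := by
  induction p with
  | zero =>
    refine (solvesBessel_const_mul_exp 1 ν 1 (μ - 1)).congr (fun z => by simp [coeff])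
      fun z => ?_
    rw [coeff_succ]
    have e : μ - 1 + 2 = μ + 1 := by ring
    simp only [e, coeff]
    simp
    ring
  | succ p ih =>
    refine (ih.add (solvesBessel_const_mul_exp 1 ν ((-1) ^ (p + 1) * coeff μ ν (p + 1))
      (μ - 1 - 2 * (p + 1 : ℕ)))).congr (fun z => by rw [Finset.sum_range_succ]) fun z => ?_
    have e : μ - 1 - 2 * ((p + 1 : ℕ) : ℂ) + 2 = μ - 1 - 2 * p := by push_cast; ring
    rw [e, coeff_succ μ ν (p + 1)]
    push_cast
    ring

theorem coeff_succ_eq_zero (h : μ + ν = 2 * p + 1 ∨ μ - ν = 2 * p + 1) :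
    coeff μ ν (p + 1) = 0 := by
  rw [coeff_succ]
  refine mul_eq_zero_of_right _ ?_
  push_cast
  rcases h with h | h
  · linear_combination (μ - 2 * (p + 1) + 1 - ν) * h
  · linear_combination (μ - 2 * (p + 1) + 1 + ν) * h

theorem descending_eq (μ ν : ℂ) (p : ℕ) (z : ℂ) :
    exp ((μ - 1) * z) * ∑ k ∈ Finset.range (p + 1), (-1) ^ k * coeff μ ν k * exp (-2 * k * z) =
      ∑ k ∈ Finset.range (p + 1), (-1) ^ k * coeff μ ν k * exp ((μ - 1 - 2 * k) * z) := by
  rw [Finset.mul_sum]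
  refine Finset.sum_congr rfl fun k _ => ?_
  rw [mul_left_comm, ← Complex.exp_add]
  ring_nf

/-- Under the condition the descending series terminates and is a solution. -/
theorem solvesBessel_descending (h : μ + ν = 2 * p + 1 ∨ μ - ν = 2 * p + 1) :
    SolvesBessel 1 ν (fun z => exp ((μ + 1) * z)) (fun z => exp ((μ - 1) * z) *
      ∑ k ∈ Finset.range (p + 1), (-1) ^ k * coeff μ ν k * exp (-2 * k * z)) :=
  (solvesBessel_descending_aux μ ν p).congr (descending_eq μ ν p) fun z => by
    rw [coeff_succ_eq_zero h]; simp

theorem finiteGrowth_descending (μ ν : ℂ) (p : ℕ) : FiniteGrowth (fun z => exp ((μ - 1) * z) *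
      ∑ k ∈ Finset.range (p + 1), (-1) ^ k * coeff μ ν k * exp (-2 * k * z)) := by
  rw [funext (descending_eq μ ν p)]
  exact FiniteGrowth.sum _ fun k _ => (FiniteGrowth.exp_mul _).const_mul _

end descending

section finiteGrowth

variable {μ ν : ℂ}

theorem finiteGrowth_lommelSubOneLog {n : ℕ} (hn : n ≠ 0) :
    FiniteGrowth (lommelSubOneLog n) := by
  have hν : ∀ k : ℕ, (n : ℂ) ≠ -(k : ℂ) := fun k h => by
    have : ((n + k : ℕ) : ℂ) = 0 := by push_cast; linear_combination h
    have := Nat.cast_eq_zero.1 this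
    omega
  have e : ∀ z, lommelSubOneLog n z =
      (1 / 4) * Gamma n * (2 : ℂ) ^ (n : ℂ) * besselYPolar n (z + -log 2) := by
    intro z
    rw [lommelSubOneLog_eq hν, besselYLog_natCast, besselYNatLog_eq,
      Complex.cpow_sub _ _ two_ne_zero, ← sub_eq_add_neg,
      show (2 : ℂ) ^ (2 : ℂ) = 4 by norm_num [← Nat.cast_ofNat (R := ℂ) (n := 2), Complex.cpow_ofNat]]
    have : (Real.pi : ℂ) ≠ 0 := ofReal_ne_zero.2 Real.pi_ne_zero
    field_simp
    ring
  rw [funext e]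
  refine FiniteGrowth.const_mul _ (FiniteGrowth.comp_add ?_ _)
  exact FiniteGrowth.sum _ fun k _ => (FiniteGrowth.exp_mul _).const_mul _

theorem finiteGrowth_lommelSingularLog {n : ℕ} (hn : n ≠ 0) (q : ℕ) :
    FiniteGrowth (lommelSingularLog q n) := by
  have h1 : FiniteGrowth fun z => ∑ m ∈ Finset.range q, (-1 : ℂ) ^ m /
      ((2 : ℂ) ^ (2 * m + 2) * (ascPochhammer ℂ (m + 1)).eval (-(q : ℂ)) *
        (ascPochhammer ℂ (m + 1)).eval ((n : ℂ) - q)) * exp (((n : ℂ) - 2 * q + 2 * m) * z) :=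
    FiniteGrowth.sum _ fun k _ => (FiniteGrowth.exp_mul _).const_mul _
  have h2 := (finiteGrowth_lommelSubOneLog hn).const_mul ((-1 : ℂ) ^ q /
    ((2 : ℂ) ^ (2 * q) * (q.factorial : ℂ) * (ascPochhammer ℂ q).eval (1 - (n : ℂ))))
  convert h1.add h2 using 2 with z
  rw [lommelSingularLog]
  congr 1
  · exact Finset.sum_congr rfl fun k _ => by ring
  · ring

/-- If `μ - ν = 2p + 1`, the series `s_{μ,ν}` is the negative of the tail, from index `p + 1` on, of
the multiple of `J_ν` that is added to it. -/
theorem smallLommelCoeff_eq_neg {p : ℕ} (h : μ - ν = 2 * p + 1)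
    (h2 : ∀ q : ℕ, μ + ν ≠ -(2 * q + 1)) (m : ℕ) :
    smallLommelCoeff μ ν m * (2 : ℂ) ^ (μ + 1 + 2 * m) =
      -((2 : ℂ) ^ (μ - 1) * Gamma (p + 1) * Gamma (ν + p + 1) * (-1) ^ p *
        besselCoeff ν (m + (p + 1))) := by
  obtain rfl : μ = ν + 2 * p + 1 := by linear_combination h
  have hne : ∀ k : ℕ, ν + p + 1 + k ≠ 0 := fun k hk => h2 k (by linear_combination 2 * hk)
  have hfac : ∀ j : ℕ, (ν + 2 * p + 1 + 2 * j + 1) ^ 2 - ν ^ 2 ≠ 0 := fun j => by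
    have e : (ν + 2 * p + 1 + 2 * j + 1) ^ 2 - ν ^ 2 =
      4 * ((p + j + 1 : ℕ) : ℂ) * (ν + p + 1 + j) := by push_cast; ring
    rw [e]
    exact mul_ne_zero (mul_ne_zero (by norm_num) (Nat.cast_ne_zero.2 (by omega))) (hne j)
  induction m with
  | zero =>
    have hG : Gamma (ν + p + 1) ≠ 0 := Gamma_ne_zero fun k hk => hne k (by rw [hk]; ring)
    have h0 := hfac 0
    have hn0 := hne 0
    simp only [Nat.cast_zero, mul_zero, add_zero] at h0 hn0
    have e1 : (2 : ℂ) ^ (ν + 2 * p + 1 + 1 + 2 * ((0 : ℕ) : ℂ)) =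
        4 * (2 : ℂ) ^ (ν + 2 * p + 1 - 1) := by
      rw [show ν + 2 * p + 1 + 1 + 2 * ((0 : ℕ) : ℂ) = ν + 2 * p + 1 - 1 + 2 by push_cast; ring,
        Complex.cpow_add _ _ two_ne_zero, Complex.cpow_ofNat]
      ring
    rw [e1, smallLommelCoeff, besselCoeff, Gamma_nat_eq_factorial, zero_add (p + 1),
      Nat.factorial_succ,
      show ν + ((p + 1 : ℕ) : ℂ) + 1 = (ν + p + 1) + 1 by push_cast; ring, Gamma_add_one _ hn0]
    have e2 : (ν + 2 * p + 1 + 1) ^ 2 - ν ^ 2 = 4 * (p + 1) * (ν + p + 1) := by ring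
    simp only [zero_add, Finset.range_one, Finset.prod_singleton, Nat.cast_zero, mul_zero,
      add_zero, e2, pow_zero]
    have hf : (p.factorial : ℂ) ≠ 0 := by exact_mod_cast p.factorial_ne_zero
    have hp : (p : ℂ) + 1 ≠ 0 := Nat.cast_add_one_ne_zero p
    have hs : ((-1 : ℂ) ^ p) * (-1) ^ p = 1 := by rw [← mul_pow]; simp
    push_cast
    rw [pow_succ]
    field_simp
    linear_combination -hs
  | succ m ih =>
    have hm := hfac (m + 1)
    have e1 : (2 : ℂ) ^ (ν + 2 * p + 1 + 1 + 2 * ((m + 1 : ℕ) : ℂ)) =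
        4 * (2 : ℂ) ^ (ν + 2 * p + 1 + 1 + 2 * (m : ℂ)) := by
      rw [show ν + 2 * p + 1 + 1 + 2 * ((m + 1 : ℕ) : ℂ) = ν + 2 * p + 1 + 1 + 2 * (m : ℂ) + 2 by
        push_cast; ring, Complex.cpow_add _ _ two_ne_zero, Complex.cpow_ofNat]
      ring
    have r1 := smallLommelCoeff_succ hfac m
    have r2 := besselCoeff_succ ν (m + (p + 1))
    apply mul_left_cancel₀ hm
    rw [e1, show m + 1 + (p + 1) = m + (p + 1) + 1 by ring]
    push_cast at r1 r2 ⊢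
    linear_combination 4 * (2 : ℂ) ^ (ν + 2 * p + 1 + 1 + 2 * (m : ℂ)) * r1 - 4 * ih +
      4 * ((2 : ℂ) ^ (ν + 2 * p + 1 - 1) * Gamma (p + 1) * Gamma (ν + p + 1) * (-1) ^ p) * r2

theorem finiteGrowth_lommelGenericLog_of_sub {p : ℕ} (h : μ - ν = 2 * p + 1)
    (h2 : ∀ q : ℕ, μ + ν ≠ -(2 * q + 1)) : FiniteGrowth (lommelGenericLog μ ν) := by
  have hcos : cos ((μ - ν) / 2 * Real.pi) = 0 := by
    rw [h, show (2 * p + 1 : ℂ) / 2 * Real.pi = p * Real.pi + Real.pi / 2 by ring,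
      Complex.cos_add_pi_div_two, Complex.sin_nat_mul_pi, neg_zero]
  have hcos' : cos (p * Real.pi) = (-1) ^ p := by
    have := congrArg ofReal (Real.cos_nat_mul_pi p)
    push_cast at this
    exact this
  have hsin : sin ((μ - ν) / 2 * Real.pi) = (-1) ^ p := by
    rw [h, show (2 * p + 1 : ℂ) / 2 * Real.pi = p * Real.pi + Real.pi / 2 by ring,
      Complex.sin_add_pi_div_two, hcos']
  have hg1 : (μ - ν + 1) / 2 = p + 1 := by rw [h]; ring
  have hg2 : (μ + ν + 1) / 2 = ν + p + 1 := by linear_combination h / 2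
  set K : ℂ := (2 : ℂ) ^ (μ - 1) * Gamma (p + 1) * Gamma (ν + p + 1) * (-1) ^ p with hK
  have e : ∀ z, lommelGenericLog μ ν z = K * ∑ i ∈ Finset.range (p + 1),
      besselCoeff ν i * exp ((ν + 2 * i) * (z + -log 2)) := by
    intro z
    rw [lommelGenericLog, hcos, hsin, hg1, hg2, besselJLog_eq, smallLommelLog_eq,
      expSeries, expSeries, ← sub_eq_add_neg]
    have hs := (rapidDecay_besselCoeff ν).summable ν (z - log 2)
    rw [← hs.sum_add_tsum_nat_add (p + 1)]
    have ht : ∑' m : ℕ, smallLommelCoeff μ ν m * exp ((μ + 1 + 2 * m) * z) =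
        -(K * ∑' i : ℕ, besselCoeff ν (i + (p + 1)) *
          exp ((ν + 2 * (i + (p + 1) : ℕ)) * (z - log 2))) := by
      rw [← tsum_mul_left, ← tsum_neg]
      refine tsum_congr fun m => ?_
      rw [show ν + 2 * ((m + (p + 1) : ℕ) : ℂ) = μ + 1 + 2 * m by
        push_cast; linear_combination -h, two_cpow_mul, ← mul_assoc,
        smallLommelCoeff_eq_neg h h2 m]
      ring
    rw [ht, hK]
    ring
  rw [funext e]
  refine FiniteGrowth.const_mul _ (FiniteGrowth.comp_add (f := fun z =>
    ∑ i ∈ Finset.range (p + 1), besselCoeff ν i * exp ((ν + 2 * i) * z)) ?_ _)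
  exact FiniteGrowth.sum _ fun k _ => (FiniteGrowth.exp_mul _).const_mul _

/-- `S_{μ,ν}` is even in `ν`; stated where `Y_ν` is given by the quotient formula. -/
theorem lommelGenericLog_neg (h1 : ∀ n : ℕ, ν ≠ n) (h2 : ∀ n : ℕ, ν ≠ -(n : ℂ)) (μ z : ℂ) :
    lommelGenericLog μ (-ν) z = lommelGenericLog μ ν z := by
  have hs : sin (ν * Real.pi) ≠ 0 := by
    rw [Complex.sin_ne_zero_iff]
    intro k hk
    have hk' := mul_right_cancel₀ (ofReal_ne_zero.2 Real.pi_ne_zero) hk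
    obtain ⟨n, rfl | rfl⟩ := k.eq_nat_or_neg
    · exact h1 n (by simpa using hk')
    · exact h2 n (by simpa using hk')
  have y1 : besselYLog ν z = (besselJLog ν z * cos (ν * Real.pi) - besselJLog (-ν) z) /
      sin (ν * Real.pi) := by
    rw [besselYLog, dif_neg (fun ⟨n, h⟩ => h1 n h), dif_neg (fun ⟨n, h⟩ => h2 n h)]
  have y2 : besselYLog (-ν) z = (besselJLog (-ν) z * cos (ν * Real.pi) - besselJLog ν z) /
      -sin (ν * Real.pi) := by
    rw [besselYLog, dif_neg (fun ⟨n, h⟩ => h2 n (by linear_combination -h)),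
      dif_neg (fun ⟨n, h⟩ => h1 n (neg_injective h)), neg_mul, Complex.cos_neg,
      Complex.sin_neg, neg_neg]
  have s1 : smallLommelLog μ (-ν) z = smallLommelLog μ ν z := by
    simp only [smallLommelLog, neg_sq]
  have hB : (μ - -ν) / 2 * Real.pi = (μ - ν) / 2 * Real.pi + ν * Real.pi := by ring
  rw [lommelGenericLog, lommelGenericLog, s1, y1, y2, hB, Complex.cos_add, Complex.sin_add,
    sub_neg_eq_add, ← sub_eq_add_neg]
  have hsq := Complex.sin_sq_add_cos_sq (ν * Real.pi)
  generalize (μ - ν) / 2 * (Real.pi : ℂ) = A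
  generalize ν * (Real.pi : ℂ) = B at hs hsq
  rw [mul_assoc ((2 : ℂ) ^ (μ - 1)), mul_comm (Gamma ((μ + ν + 1) / 2)), ← mul_assoc]
  congr 2
  field_simp
  linear_combination besselJLog (-ν) z * cos A * hsq

theorem finiteGrowth_lommelLog (h : ∃ p : ℕ, μ + ν = 2 * p + 1 ∨ μ - ν = 2 * p + 1) :
    FiniteGrowth (lommelLog μ ν) := by
  obtain ⟨p, h⟩ := h
  have hcontra : ∀ (p q : ℕ) (x : ℂ), x = 2 * p + 1 → x ≠ -(2 * q + 1) := by
    intro p q x hx hx'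
    have : ((2 * p + 2 * q + 2 : ℕ) : ℂ) = 0 := by push_cast; linear_combination hx' - hx
    have := Nat.cast_eq_zero.1 this
    omega
  by_cases h1 : ∃ p : ℕ, μ - ν = -(2 * p + 1) ∧ ∀ n : ℕ, 1 ≤ n → n ≤ p → ν ≠ n
  · have hs := h1.choose_spec
    have e : lommelLog μ ν = lommelSingularLog h1.choose ν := funext fun z => by
      rw [lommelLog, dif_pos h1]
    rw [e]
    have hp := h.resolve_right fun h => hcontra _ _ _ h hs.1
    have hν : ν = ((p + h1.choose + 1 : ℕ) : ℂ) := by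
      push_cast; linear_combination (hp - hs.1) / 2
    have := finiteGrowth_lommelSingularLog (Nat.succ_ne_zero (p + h1.choose)) h1.choose
    rwa [← hν] at this
  by_cases h2 : ∃ p : ℕ, μ + ν = -(2 * p + 1)
  · have hs := h2.choose_spec
    have e : lommelLog μ ν = lommelSingularLog h2.choose (-ν) := funext fun z => by
      rw [lommelLog, dif_neg h1, dif_pos h2]
    rw [e]
    have hp := h.resolve_left fun h => hcontra _ _ _ h hs
    have hν : -ν = ((p + h2.choose + 1 : ℕ) : ℂ) := by
      push_cast; linear_combination (hp - hs) / 2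
    have := finiteGrowth_lommelSingularLog (Nat.succ_ne_zero (p + h2.choose)) h2.choose
    rwa [← hν] at this
  · have e : lommelLog μ ν = lommelGenericLog μ ν := funext fun z => by
      rw [lommelLog, dif_neg h1, dif_neg h2]
    rw [e]
    have hsub := sub_ne_of_lommel_generic h1 h2
    have hadd : ∀ p : ℕ, μ + ν ≠ -(2 * p + 1) := fun p h => h2 ⟨p, h⟩
    rcases h with h | h
    · by_cases hint : ∃ k : ℤ, ν = k
      · -- for integral `ν` both `μ + ν` and `μ - ν` are odd, and `μ - ν` is positive
        obtain ⟨k, rfl⟩ := hint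
        have h' : μ - k = 2 * ((p - k : ℤ) : ℂ) + 1 := by push_cast; linear_combination h
        obtain ⟨n, hn | hn⟩ := (p - k : ℤ).eq_nat_or_neg
        · exact finiteGrowth_lommelGenericLog_of_sub (p := n) (by rw [h', hn]; simp) hadd
        · rcases Nat.eq_zero_or_pos n with rfl | hpos
          · exact finiteGrowth_lommelGenericLog_of_sub (p := 0) (by rw [h', hn]; simp) hadd
          · refine absurd ?_ (hsub (n - 1))
            rw [h', hn, Nat.cast_sub hpos]; push_cast; ring
      · rw [← funext (lommelGenericLog_neg (fun n hn => hint ⟨n, by simpa using hn⟩)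
          (fun n hn => hint ⟨-n, by simpa using hn⟩) μ)]
        exact finiteGrowth_lommelGenericLog_of_sub (p := p) (by linear_combination h)
          fun q hq => hsub q (by linear_combination hq)
    · exact finiteGrowth_lommelGenericLog_of_sub h hadd

end finiteGrowth

end LommelFn

theorem theorem1p5 (μ ν : ℂ) (m : ℤ) :
    ∃ F : ℂ → ℂ, Differentiable ℂ F ∧
      (∀ z : ℂ, -Real.pi < z.im → z.im < Real.pi →
        F z = LommelFn.lommelBranch μ ν m (Complex.exp z)) ∧
      (LommelFn.growthOrder F < ⊤ ↔ ∃ p : ℕ, μ + ν = 2 * p + 1 ∨ μ - ν = 2 * p + 1) ∧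
      (∀ p : ℕ, μ + ν = 2 * p + 1 ∨ μ - ν = 2 * p + 1 →
        ∀ z : ℂ, F z = Complex.exp ((μ - 1) * (z + m * Real.pi * Complex.I)) *
          ∑ k ∈ Finset.range (p + 1),
            (-1 : ℂ) ^ k * LommelFn.coeff μ ν k * Complex.exp (-2 * k * z)) := by
  have hL := LommelFn.solvesBessel_lommelLog μ ν
  have hd := hL.differentiable
  have hF : Differentiable ℂ fun z => LommelFn.lommelLog μ ν (z + m * Real.pi * Complex.I) := by
    fun_prop
  refine ⟨fun z => LommelFn.lommelLog μ ν (z + m * Real.pi * Complex.I), hF, fun z h1 h2 => ?_,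
    ⟨fun h => ?_, fun h => ?_⟩, fun p h z => ?_⟩
  · rw [LommelFn.lommelBranch, Complex.log_exp h1 h2.le]
  · have hg : LommelFn.FiniteGrowth (LommelFn.lommelLog μ ν) := by
      simpa using (LommelFn.FiniteGrowth.of_growthOrder_lt_top hF.continuous h).comp_add
        (-(m * Real.pi * Complex.I))
    obtain ⟨j, hj, e⟩ := LommelFn.exists_sq_eq_of_finiteGrowth hL hg
    obtain ⟨p, rfl⟩ := Nat.exists_eq_add_of_le' hj
    have e2 : (μ + ν - (2 * p + 1)) * (μ - ν - (2 * p + 1)) = 0 := by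
      push_cast at e; linear_combination e
    exact ⟨p, (mul_eq_zero.1 e2).imp sub_eq_zero.1 sub_eq_zero.1⟩
  · exact ((LommelFn.finiteGrowth_lommelLog h).comp_add _).growthOrder_lt_top hF.continuous
  · have := LommelFn.eq_of_finiteGrowth hL (LommelFn.solvesBessel_descending h)
      (LommelFn.finiteGrowth_lommelLog ⟨p, h⟩) (LommelFn.finiteGrowth_descending μ ν p)
      (z + m * Real.pi * Complex.I)
    refine this.trans ?_
    congr 1
    refine Finset.sum_congr rfl fun k _ => ?_
    congr 1
    rw [mul_add, Complex.exp_add, show (-2 * k : ℂ) * (m * Real.pi * Complex.I) =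
      ((-(k * m) : ℤ) : ℂ) * (2 * Real.pi * Complex.I) by push_cast; ring,
      Complex.exp_int_mul_two_pi_mul_I, mul_one]
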